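/- Let $\mathbb F$ be a field of characteristic not $2$; algebras over $\mathbb F$ are commutative but not necessarily associative or unital. For an element $a$ of an algebra $A$ and $\mu\in\mathbb F$ put $A_\mu(a)=\{u\in A\mid au=\mu u\}$. A non-zero idempotent $a\in A$ is an axis (of Jordan type half) if $A=A_1(a)\oplus A_0(a)\oplus A_{1/2}(a)$ and $A_1(a)A_1(a)\subseteq A_1(a)$, $A_1(a)A_0(a)=0$, $A_0(a)A_0(a)\subseteq A_0(a)$, $(A_1(a)\oplus A_0(a))A_{1/2}(a)\subseteq A_{1/2}(a)$, $A_{1/2}(a)A_{1/2}(a)\subseteq A_1(a)\oplus A_0(a)$; it is a primitive axis if moreover $A_1(a)=\mathbb F a$. Let $A$ be an algebra of Jordan type half, that is, an algebra generated by a set $X$ of primitive axes, and let $(\cdot,\cdot)$ be its Frobenius form, that is, the unique non-zero bilinear form on $A$ with $(uv,w)=(u,vw)$ for all $u,v,w\in A$ and $(x,x)=1$ for all $x\in X$. Let $a,b\in A$ be primitive axes (not necessarily in $X$) with $(a,b)\notin\{0,\tfrac14,1\}$, and let $J=\langle\langle a,b\rangle\rangle$ be the subalgebra generated by $a$ and $b$.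 Then $J$ is solid, that is, every idempotent $c\in J$ with $c\ne 0$ and $c\neq 1_J$ (the identity element of $J$) is a primitive axis of the whole algebra $A$. -/

import Mathlib

/-! Algebras are commutative, not assumed associative or unital, over a field of
characteristic not `2`. -/

namespace JordanHalf

section Definitions

variable (F : Type*) {A : Type*} [Field F] [NonUnitalNonAssocCommRing A] [Module F A]
  [IsScalarTower F A A] [SMulCommClass F A A]

/-- The `μ`-eigenspace `A_μ(a) = {u | a u = μ u}` of the adjoint map of `a`. -/
def adEigenspace (a : A) (μ : F) : Submodule F A :=
  Module.End.eigenspace (LinearMap.mul F A a) μ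

/-- `a` is an axis for the Jordan fusion law of type half: a non-zero idempotent whose adjoint
map is semisimple with eigenvalues in `{1, 0, 1/2}`, the eigenspaces multiplying by the rules
`1*1 = {1}`, `1*0 = ∅`, `0*0 = {0}`, `1*½ = {½}`, `0*½ = {½}`, `½*½ = {1, 0}`. -/
structure IsAxis (a : A) : Prop where
  ne_zero : a ≠ 0
  idem : a * a = a
  semisimple : adEigenspace F a 1 ⊔ adEigenspace F a 0 ⊔ adEigenspace F a (1 / 2) = ⊤
  one_one : ∀ x ∈ adEigenspace F a 1, ∀ y ∈ adEigenspace F a 1, x * y ∈ adEigenspace F a 1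
  one_zero : ∀ x ∈ adEigenspace F a 1, ∀ y ∈ adEigenspace F a 0, x * y = 0
  zero_zero : ∀ x ∈ adEigenspace F a 0, ∀ y ∈ adEigenspace F a 0, x * y ∈ adEigenspace F a 0
  one_half : ∀ x ∈ adEigenspace F a 1, ∀ y ∈ adEigenspace F a (1 / 2),
    x * y ∈ adEigenspace F a (1 / 2)
  zero_half : ∀ x ∈ adEigenspace F a 0, ∀ y ∈ adEigenspace F a (1 / 2),
    x * y ∈ adEigenspace F a (1 / 2)
  half_half : ∀ x ∈ adEigenspace F a (1 / 2), ∀ y ∈ adEigenspace F a (1 / 2),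
    x * y ∈ adEigenspace F a 1 ⊔ adEigenspace F a 0

/-- An axis `a` is primitive if `A_1(a)` is the line spanned by `a`. -/
structure IsPrimitiveAxis (a : A) : Prop extends IsAxis F a where
  primitive : adEigenspace F a 1 = Submodule.span F {a}

/-- `(A, X)` is an algebra of Jordan type half: `X` is a set of primitive axes that
generates `A`. -/
structure IsJordanTypeHalf (X : Set A) : Prop where
  axes : ∀ x ∈ X, IsPrimitiveAxis F x
  generates : NonUnitalAlgebra.adjoin F X = ⊤

/-- A Frobenius form on `(A, X)`, i.e. a non-zero bilinear form associating with the product,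
normalized by `(x, x) = 1` for the generating axes `x ∈ X`. -/
structure IsFrobeniusForm (X : Set A) (B : LinearMap.BilinForm F A) : Prop where
  ne_zero : B ≠ 0
  assoc : ∀ u v w : A, B (u * v) w = B u (v * w)
  normalized : ∀ x ∈ X, B x x = 1

/-- The subalgebra `J` of `A` is solid: every idempotent of `J` other than `0` and the identity
element of `J` (if there is one) is a primitive axis of the whole algebra `A`. -/
def IsSolid (J : NonUnitalSubalgebra F A) : Prop :=
  ∀ c ∈ J, c * c = c → c ≠ 0 → ¬ (∀ x ∈ J, c * x = x) → IsPrimitiveAxis F c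

end Definitions

section Existence

variable {F A : Type*} [Field F] [NonUnitalNonAssocCommRing A] [Module F A]
  [IsScalarTower F A A] [SMulCommClass F A A]

theorem mem_adEigenspace {a u : A} {μ : F} : u ∈ adEigenspace F a μ ↔ a * u = μ • u := by
  simp [adEigenspace]

theorem mem_zero {a u : A} : u ∈ adEigenspace F a 0 ↔ a * u = 0 := by
  simp [mem_adEigenspace]

theorem self_mem_one {a : A} (ha : IsAxis F a) : a ∈ adEigenspace F a 1 := by
  simp [mem_adEigenspace, ha.idem]

theorem IsPrimitiveAxis.decomp {a : A} (ha : IsPrimitiveAxis F a) (u : A) :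
    ∃ (r : F) (u0 uh : A), u = r • a + u0 + uh ∧ u0 ∈ adEigenspace F a 0 ∧
      uh ∈ adEigenspace F a (1 / 2) := by
  have h : u ∈ adEigenspace F a 1 ⊔ adEigenspace F a 0 ⊔ adEigenspace F a (1 / 2) := by
    rw [ha.semisimple]; trivial
  obtain ⟨p, hp, uh, huh, rfl⟩ := Submodule.mem_sup.1 h
  obtain ⟨u1, hu1, u0, hu0, rfl⟩ := Submodule.mem_sup.1 hp
  rw [ha.primitive] at hu1
  obtain ⟨r, rfl⟩ := Submodule.mem_span_singleton.1 hu1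
  exact ⟨r, u0, uh, rfl, hu0, huh⟩

/-- The coordinate of the projection to `A_1(a) = ⟨a⟩`. -/
theorem IsPrimitiveAxis.exists_proj [NeZero (2 : F)] {a : A} (ha : IsPrimitiveAxis F a) :
    ∃ L : A →ₗ[F] F, ∀ (r : F) (u0 uh : A), u0 ∈ adEigenspace F a 0 →
      uh ∈ adEigenspace F a (1 / 2) → L (r • a + u0 + uh) = r := by
  have h2 : (2 : F) ≠ 0 := NeZero.ne _
  have key : ∀ (r : F) (u0 uh : A), u0 ∈ adEigenspace F a 0 → uh ∈ adEigenspace F a (1 / 2) →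
      (2 : F) • (a * (a * (r • a + u0 + uh))) - a * (r • a + u0 + uh) = r • a := by
    intro r u0 uh h0 hh
    rw [mem_zero] at h0
    rw [mem_adEigenspace] at hh
    simp only [mul_add, mul_smul_comm, ha.idem, h0, hh, mul_zero]
    match_scalars <;> field_simp <;> ring
  have hP : ∀ u : A, ∃ r : F, (2 : F) • (a * (a * u)) - a * u = r • a := by
    intro u
    obtain ⟨r, u0, uh, rfl, h0, hh⟩ := ha.decomp u
    exact ⟨r, key r u0 uh h0 hh⟩
  choose f hf using hP
  have inj : ∀ {r s : F}, r • a = s • a → r = s := fun h => smul_left_injective F ha.ne_zero h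
  refine ⟨{ toFun := f, map_add' := ?_, map_smul' := ?_ }, ?_⟩
  · intro u v
    apply inj
    rw [← hf, add_smul, ← hf, ← hf]
    simp only [mul_add, smul_add]
    abel
  · intro c u
    apply inj
    rw [← hf, RingHom.id_apply, smul_assoc, ← hf]
    simp only [mul_smul_comm, smul_sub]
    rw [smul_comm]
  · intro r u0 uh h0 hh
    apply inj
    exact (hf _).symm.trans (key r u0 uh h0 hh)

theorem IsAxis.seress {a : A} (ha : IsPrimitiveAxis F a) (v : A) {w : A}
    (hw : w ∈ adEigenspace F a 1 ⊔ adEigenspace F a 0) : a * (v * w) = (a * v) * w := by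
  obtain ⟨w1, hw1, w0, hw0, rfl⟩ := Submodule.mem_sup.1 hw
  rw [ha.primitive] at hw1
  obtain ⟨s, rfl⟩ := Submodule.mem_span_singleton.1 hw1
  obtain ⟨r, v0, vh, rfl, h0, hh⟩ := ha.decomp v
  have e1 := mem_zero.1 (ha.zero_zero _ h0 _ hw0)
  have e2 := mem_adEigenspace.1 (ha.zero_half _ hw0 _ hh)
  rw [mul_comm w0 vh] at e2
  rw [mem_zero] at h0 hw0
  rw [mem_adEigenspace] at hh
  simp only [mul_add, add_mul, mul_smul_comm, smul_mul_assoc, ha.idem, h0, hw0, hh, e1, e2,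
    mul_comm _ a, mul_zero, zero_mul, smul_zero]

/-- The Miyamoto involution of `a`, as a linear map. -/
def tau (a : A) : A →ₗ[F] A :=
  LinearMap.id - (8 : F) • (LinearMap.mul F A a - LinearMap.mul F A a ∘ₗ LinearMap.mul F A a)

theorem tau_apply (a u : A) : tau (F := F) a u = u - (8 : F) • (a * u - a * (a * u)) := by
  simp [tau]

theorem tau_plus {a u : A} (hu : u ∈ adEigenspace F a 1 ⊔ adEigenspace F a 0) :
    tau (F := F) a u = u := by
  obtain ⟨x, hx, y, hy, rfl⟩ := Submodule.mem_sup.1 hu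
  rw [mem_zero] at hy
  rw [mem_adEigenspace, one_smul] at hx
  simp [tau_apply, mul_add, hx, hy]

theorem tau_half [NeZero (2 : F)] {a u : A} (hu : u ∈ adEigenspace F a (1 / 2)) :
    tau (F := F) a u = -u := by
  have h2 : (2 : F) ≠ 0 := NeZero.ne _
  rw [mem_adEigenspace] at hu
  simp only [tau_apply, hu, mul_smul_comm]
  match_scalars
  field_simp
  norm_num

theorem IsAxis.decomp_pm {a : A} (ha : IsAxis F a) (u : A) :
    ∃ p ∈ adEigenspace F a 1 ⊔ adEigenspace F a 0, ∃ h ∈ adEigenspace F a (1 / 2),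
      p + h = u := by
  have h : u ∈ adEigenspace F a 1 ⊔ adEigenspace F a 0 ⊔ adEigenspace F a (1 / 2) := by
    rw [ha.semisimple]; trivial
  exact Submodule.mem_sup.1 h

theorem IsAxis.plus_plus {a u v : A} (ha : IsAxis F a)
    (hu : u ∈ adEigenspace F a 1 ⊔ adEigenspace F a 0)
    (hv : v ∈ adEigenspace F a 1 ⊔ adEigenspace F a 0) :
    u * v ∈ adEigenspace F a 1 ⊔ adEigenspace F a 0 := by
  obtain ⟨x, hx, y, hy, rfl⟩ := Submodule.mem_sup.1 hu
  obtain ⟨z, hz, w, hw, rfl⟩ := Submodule.mem_sup.1 hv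
  rw [Submodule.mem_sup]
  refine ⟨x * z, ha.one_one _ hx _ hz, y * w, ha.zero_zero _ hy _ hw, ?_⟩
  rw [add_mul, mul_add, mul_add, ha.one_zero _ hx _ hw, mul_comm y z, ha.one_zero _ hz _ hy]
  simp

theorem IsAxis.plus_half {a u v : A} (ha : IsAxis F a)
    (hu : u ∈ adEigenspace F a 1 ⊔ adEigenspace F a 0) (hv : v ∈ adEigenspace F a (1 / 2)) :
    u * v ∈ adEigenspace F a (1 / 2) := by
  obtain ⟨x, hx, y, hy, rfl⟩ := Submodule.mem_sup.1 hu
  rw [add_mul]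
  exact add_mem (ha.one_half _ hx _ hv) (ha.zero_half _ hy _ hv)

theorem IsAxis.tau_mul [NeZero (2 : F)] {a : A} (ha : IsAxis F a) (u v : A) :
    tau (F := F) a (u * v) = tau (F := F) a u * tau (F := F) a v := by
  obtain ⟨p, hp, h, hh, rfl⟩ := ha.decomp_pm u
  obtain ⟨q, hq, k, hk, rfl⟩ := ha.decomp_pm v
  have e : (p + h) * (q + k) = (p * q + h * k) + (p * k + q * h) := by
    rw [add_mul, mul_add, mul_add, mul_comm h q]; abel
  rw [e, map_add, tau_plus (add_mem (ha.plus_plus hp hq) (ha.half_half _ hh _ hk)),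
    tau_half (add_mem (ha.plus_half hp hk) (ha.plus_half hq hh)), map_add, map_add,
    tau_plus hp, tau_plus hq, tau_half hh, tau_half hk]
  simp only [mul_add, add_mul, mul_neg, neg_mul, mul_comm h q]
  abel

theorem IsAxis.tau_tau [NeZero (2 : F)] {a : A} (ha : IsAxis F a) (u : A) :
    tau (F := F) a (tau (F := F) a u) = u := by
  obtain ⟨p, hp, h, hh, rfl⟩ := ha.decomp_pm u
  simp [tau_plus hp, tau_half hh]

theorem IsAxis.tau_mem [NeZero (2 : F)] {a b u : A} {μ : F} (ha : IsAxis F a) :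
    tau (F := F) a u ∈ adEigenspace F (tau (F := F) a b) μ ↔ u ∈ adEigenspace F b μ := by
  rw [mem_adEigenspace, mem_adEigenspace, ← ha.tau_mul, ← map_smul]
  exact (Function.Involutive.injective ha.tau_tau).eq_iff

theorem IsAxis.exists_tau_mem [NeZero (2 : F)] {a b u : A} {μ : F} (ha : IsAxis F a)
    (hu : u ∈ adEigenspace F (tau (F := F) a b) μ) :
    ∃ v ∈ adEigenspace F b μ, tau (F := F) a v = u := by
  refine ⟨tau (F := F) a u, ?_, ha.tau_tau u⟩
  rw [← ha.tau_mem, ha.tau_tau]; exact hu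

theorem IsPrimitiveAxis.tau [NeZero (2 : F)] {a b : A} (ha : IsPrimitiveAxis F a)
    (hb : IsPrimitiveAxis F b) : IsPrimitiveAxis F (tau (F := F) a b) := by
  have ha' := ha.toIsAxis
  have hsup : ∀ v ∈ adEigenspace F b 1 ⊔ adEigenspace F b 0,
      JordanHalf.tau (F := F) a v ∈ adEigenspace F (JordanHalf.tau (F := F) a b) 1 ⊔
        adEigenspace F (JordanHalf.tau (F := F) a b) 0 := by
    intro v hv
    obtain ⟨x, hx, y, hy, rfl⟩ := Submodule.mem_sup.1 hv
    rw [map_add]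
    exact Submodule.add_mem_sup (ha'.tau_mem.2 hx) (ha'.tau_mem.2 hy)
  refine { ne_zero := ?_, idem := ?_, semisimple := ?_, one_one := ?_, one_zero := ?_,
           zero_zero := ?_, one_half := ?_, zero_half := ?_, half_half := ?_, primitive := ?_ }
  · intro h
    apply hb.ne_zero
    rw [← ha'.tau_tau b, h, map_zero]
  · rw [← ha'.tau_mul, hb.idem]
  · rw [eq_top_iff]
    intro u _
    obtain ⟨p, hp, h, hh, e⟩ := hb.toIsAxis.decomp_pm (JordanHalf.tau (F := F) a u)
    rw [← ha'.tau_tau u, ← e, map_add]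
    exact Submodule.add_mem_sup (hsup _ hp) (ha'.tau_mem.2 hh)
  all_goals try
    intro x' hx' y' hy'
    obtain ⟨x, hx, rfl⟩ := ha'.exists_tau_mem hx'
    obtain ⟨y, hy, rfl⟩ := ha'.exists_tau_mem hy'
    rw [← ha'.tau_mul]
  · exact ha'.tau_mem.2 (hb.one_one _ hx _ hy)
  · rw [hb.one_zero _ hx _ hy, map_zero]
  · exact ha'.tau_mem.2 (hb.zero_zero _ hx _ hy)
  · exact ha'.tau_mem.2 (hb.one_half _ hx _ hy)
  · exact ha'.tau_mem.2 (hb.zero_half _ hx _ hy)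
  · exact hsup _ (hb.half_half _ hx _ hy)
  · ext u
    rw [Submodule.mem_span_singleton]
    constructor
    · intro hu
      obtain ⟨v, hv, rfl⟩ := ha'.exists_tau_mem hu
      rw [hb.primitive] at hv
      obtain ⟨r, rfl⟩ := Submodule.mem_span_singleton.1 hv
      exact ⟨r, (map_smul _ _ _).symm⟩
    · rintro ⟨r, rfl⟩
      rw [← map_smul]
      exact ha'.tau_mem.2 (Submodule.smul_mem _ _ (self_mem_one hb.toIsAxis))

/-- Symmetry of the projection coordinates. -/
theorem proj_symm [NeZero (2 : F)] {a b : A} (ha : IsPrimitiveAxis F a)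
    (hb : IsPrimitiveAxis F b) {r s : F} {b0 bh a0 ah : A}
    (hb0 : b0 ∈ adEigenspace F a 0) (hbh : bh ∈ adEigenspace F a (1 / 2))
    (eb : b = r • a + b0 + bh)
    (ha0 : a0 ∈ adEigenspace F b 0) (hah : ah ∈ adEigenspace F b (1 / 2))
    (ea : a = s • b + a0 + ah) : r = s := by
  have h2 : (2 : F) ≠ 0 := NeZero.ne _
  have main : ∀ {a b : A} {r : F} {b0 bh : A}, IsPrimitiveAxis F a →
      b0 ∈ adEigenspace F a 0 → bh ∈ adEigenspace F a (1 / 2) → b = r • a + b0 + bh →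
      a * b = r • a + (1 / 2 : F) • bh ∧
      a * b - (1 / 2 : F) • a - (1 / 2 : F) • b ∈ adEigenspace F a 1 ⊔ adEigenspace F a 0 ∧
      a * (a * b - (1 / 2 : F) • a - (1 / 2 : F) • b) = ((r - 1) / 2) • a := by
    intro a b r b0 bh ha hb0 hbh eb
    have hb0' := mem_zero.1 hb0
    have hbh' := mem_adEigenspace.1 hbh
    have e1 : a * b = r • a + (1 / 2 : F) • bh := by
      rw [eb]; simp only [mul_add, mul_smul_comm, ha.idem, hb0', hbh', add_zero]
    have e2 : a * b - (1 / 2 : F) • a - (1 / 2 : F) • b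
        = ((r - 1) / 2) • a + (-(1 / 2) : F) • b0 := by
      rw [e1, eb]; match_scalars <;> field_simp <;> ring
    refine ⟨e1, ?_, ?_⟩
    · rw [e2]
      exact Submodule.add_mem_sup (Submodule.smul_mem _ _ (self_mem_one ha.toIsAxis))
        (Submodule.smul_mem _ _ hb0)
    · rw [e2, mul_add, mul_smul_comm, mul_smul_comm, ha.idem, hb0', smul_zero, add_zero]
  obtain ⟨p1, p2, p3⟩ := main ha hb0 hbh eb
  obtain ⟨q1, q2, q3⟩ := main hb ha0 hah ea
  have hσ : b * a - (1 / 2 : F) • b - (1 / 2 : F) • a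
      = a * b - (1 / 2 : F) • a - (1 / 2 : F) • b := by
    rw [mul_comm b a]; abel
  rw [hσ] at q2 q3
  have s1 := IsAxis.seress ha b p2
  have s2 := IsAxis.seress hb a q2
  rw [q3] at s1
  rw [p3, mul_comm b a, ← s1, mul_smul_comm, mul_smul_comm, mul_comm b a] at s2
  by_cases hab : a * b = 0
  · have z : ∀ {a b : A} {r : F} {b0 bh : A}, IsPrimitiveAxis F a →
        bh ∈ adEigenspace F a (1 / 2) → a * b = 0 →
        a * b = r • a + (1 / 2 : F) • bh → r = 0 := by
      intro a b r b0 bh ha hbh hab e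
      have hbh' := mem_adEigenspace.1 hbh
      have e' : r • a + (1 / 2 : F) • bh = 0 := by rw [← e, hab]
      have e'' : a * (r • a + (1 / 2 : F) • bh) = 0 := by rw [e', mul_zero]
      rw [mul_add, mul_smul_comm, mul_smul_comm, ha.idem, hbh'] at e''
      have : r • a = (2 : F) • (r • a + (1 / 2 : F) • (1 / 2 : F) • bh)
          - (r • a + (1 / 2 : F) • bh) := by
        match_scalars <;> field_simp <;> ring
      rw [e', e''] at this
      simpa [ha.ne_zero] using this
    rw [z (b0 := b0) ha hbh hab p1, z (b0 := a0) hb hah (by rw [mul_comm, hab]) q1]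
  · have h := smul_left_injective F hab s2
    field_simp at h
    exact (sub_left_injective h)

/-- The span of the primitive axes. -/
theorem IsJordanTypeHalf.span_axes [NeZero (2 : F)] {X : Set A} (hX : IsJordanTypeHalf F X) :
    Submodule.span F {a : A | IsPrimitiveAxis F a} = ⊤ := by
  have h2 : (2 : F) ≠ 0 := NeZero.ne _
  set S := Submodule.span F {a : A | IsPrimitiveAxis F a} with hS
  have hax : ∀ a b : A, IsPrimitiveAxis F a → IsPrimitiveAxis F b → a * b ∈ S := by
    intro a b ha hb
    obtain ⟨r, b0, bh, e, h0, hh⟩ := ha.decomp b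
    have ht : tau (F := F) a b = r • a + b0 - bh := by
      rw [e, map_add, tau_half hh, tau_plus, sub_eq_add_neg]
      exact Submodule.add_mem_sup (Submodule.smul_mem _ _ (self_mem_one ha.toIsAxis)) h0
    have h0' := mem_zero.1 h0
    have hh' := mem_adEigenspace.1 hh
    have : a * b = r • a + (1 / 4 : F) • (b - tau (F := F) a b) := by
      rw [ht]
      nth_rewrite 1 [e]
      rw [e]
      simp only [mul_add, mul_smul_comm, ha.idem, h0', hh']
      have h4 : (4 : F) ≠ 0 := by
        have : (4 : F) = 2 * 2 := by norm_num
        rw [this]; exact mul_ne_zero h2 h2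
      match_scalars <;> field_simp <;> ring
    rw [this]
    exact add_mem (Submodule.smul_mem _ _ (Submodule.subset_span ha))
      (Submodule.smul_mem _ _ (sub_mem (Submodule.subset_span hb)
        (Submodule.subset_span (ha.tau hb))))
  have hmul : ∀ u ∈ S, ∀ v ∈ S, u * v ∈ S := by
    intro u hu v hv
    refine Submodule.span_induction₂ (p := fun u v _ _ => u * v ∈ S)
      (fun a b ha hb => hax a b ha hb) ?_ ?_ ?_ ?_ ?_ ?_ hu hv
    · intro v _; simp
    · intro u _; simp
    · intro x y z _ _ _ h1 h2; rw [add_mul]; exact add_mem h1 h2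
    · intro x y z _ _ _ h1 h2; rw [mul_add]; exact add_mem h1 h2
    · intro r x y _ _ h; rw [smul_mul_assoc]; exact Submodule.smul_mem _ _ h
    · intro r x y _ _ h; rw [mul_smul_comm]; exact Submodule.smul_mem _ _ h
  rw [eq_top_iff]
  intro u _
  have hu : u ∈ NonUnitalAlgebra.adjoin F X := by rw [hX.generates]; trivial
  induction hu using NonUnitalAlgebra.adjoin_induction with
  | mem x hx => exact Submodule.subset_span (hX.axes x hx)
  | add x y _ _ h1 h2 => exact add_mem (h1 trivial) (h2 trivial)
  | zero => exact zero_mem _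
  | mul x y _ _ h1 h2 => exact hmul _ (h1 trivial) _ (h2 trivial)
  | smul r x _ h => exact Submodule.smul_mem _ _ (h trivial)

theorem exists_assoc_form [NeZero (2 : F)] {X : Set A} (hX : IsJordanTypeHalf F X) :
    ∃ B : LinearMap.BilinForm F A, (∀ u v w : A, B (u * v) w = B u (v * w)) ∧
      ∀ a : A, IsPrimitiveAxis F a → B a a = 1 := by
  have h2 : (2 : F) ≠ 0 := NeZero.ne _
  have hspan := hX.span_axes
  choose L hL using fun a : {a : A // IsPrimitiveAxis F a} => a.2.exists_proj
  have hsymm : ∀ a b : {a : A // IsPrimitiveAxis F a}, L a b = L b a := by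
    intro a b
    obtain ⟨r, b0, bh, eb, hb0, hbh⟩ := a.2.decomp b.1
    obtain ⟨s, a0, ah, ea, ha0, hah⟩ := b.2.decomp a.1
    have e1 : L a b = r := by rw [eb]; exact hL a _ _ _ hb0 hbh
    have e2 : L b a = s := by rw [ea]; exact hL b _ _ _ ha0 hah
    rw [e1, e2]
    exact proj_symm a.2 b.2 hb0 hbh eb ha0 hah ea
  have hspan' : ⊤ ≤ Submodule.span F {a : A | IsPrimitiveAxis F a} := hspan.ge
  let e := Module.Basis.ofSpan hspan'
  have he : ∀ i, IsPrimitiveAxis F (e i) := fun i =>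
    Module.Basis.ofSpan_subset hspan' ⟨i, rfl⟩
  let B : LinearMap.BilinForm F A := e.constr F (fun i => L ⟨e i, he i⟩)
  have hBe : ∀ i, B (e i) = L ⟨e i, he i⟩ := fun i => e.constr_basis F _ i
  have hB : ∀ a : {a : A // IsPrimitiveAxis F a}, B a = L a := by
    intro a
    refine e.ext fun j => ?_
    have h : B.flip (e j) = L ⟨e j, he j⟩ := by
      refine e.ext fun i => ?_
      change B (e i) (e j) = _
      rw [hBe]
      exact hsymm ⟨e i, he i⟩ ⟨e j, he j⟩
    have h' : B a.1 (e j) = L ⟨e j, he j⟩ a.1 := LinearMap.congr_fun h a.1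
    rw [h']
    exact hsymm ⟨e j, he j⟩ a
  have hBs : ∀ u v, B u v = B v u := by
    have : B = B.flip := by
      refine e.ext fun i => e.ext fun j => ?_
      change B (e i) (e j) = B (e j) (e i)
      rw [hBe, hBe]
      exact hsymm ⟨e i, he i⟩ ⟨e j, he j⟩
    intro u v
    conv_lhs => rw [this]
    rfl
  have hBt : ∀ a : A, IsPrimitiveAxis F a → ∀ u v,
      B (tau (F := F) a u) (tau (F := F) a v) = B u v := by
    intro a ha u v
    have : (B.compl₁₂ (tau (F := F) a) (tau (F := F) a)) = B := by
      refine e.ext fun i => ?_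
      ext v
      rw [LinearMap.compl₁₂_apply]
      have h1 := hB ⟨tau (F := F) a (e i), ha.tau (he i)⟩
      simp only at h1
      rw [h1, hBe]
      obtain ⟨r, v0, vh, rfl, h0, hh⟩ := (he i).decomp v
      rw [map_add (tau (F := F) a), map_add (tau (F := F) a), map_smul, hL ⟨e i, he i⟩ _ _ _ h0 hh]
      exact hL ⟨_, ha.tau (he i)⟩ _ _ _ (ha.toIsAxis.tau_mem.2 h0) (ha.toIsAxis.tau_mem.2 hh)
    conv_rhs => rw [← this]
    rfl
  have hone : ∀ a : A, IsPrimitiveAxis F a → B a a = 1 := by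
    intro a ha
    have h1 := hB ⟨a, ha⟩
    simp only at h1
    rw [h1]
    have := hL ⟨a, ha⟩ 1 0 0 (zero_mem _) (zero_mem _)
    simpa using this
  have hadj : ∀ a : A, IsPrimitiveAxis F a → ∀ u v, B (a * u) v = B u (a * v) := by
    intro a ha u v
    obtain ⟨r, u0, uh, rfl, hu0, huh⟩ := ha.decomp u
    obtain ⟨s, v0, vh, rfl, hv0, hvh⟩ := ha.decomp v
    have orth : ∀ p ∈ adEigenspace F a 1 ⊔ adEigenspace F a 0,
        ∀ h ∈ adEigenspace F a (1 / 2), B p h = 0 := by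
      intro p hp h hh
      have := hBt a ha p h
      rw [tau_plus hp, tau_half hh, map_neg] at this
      have h' : (2 : F) * B p h = 0 := by linear_combination -this
      exact (mul_eq_zero.1 h').resolve_left h2
    have orth0 : ∀ h ∈ adEigenspace F a 0, B a h = 0 := by
      intro h hh
      have h1 := hB ⟨a, ha⟩
      simp only at h1
      rw [h1]
      have := hL ⟨a, ha⟩ 0 h 0 hh (zero_mem _)
      simpa using this
    have ma : a ∈ adEigenspace F a 1 ⊔ adEigenspace F a 0 :=
      Submodule.mem_sup_left (self_mem_one ha.toIsAxis)
    have m0 : ∀ {x}, x ∈ adEigenspace F a 0 → x ∈ adEigenspace F a 1 ⊔ adEigenspace F a 0 :=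
      fun h => Submodule.mem_sup_right h
    have f1 := orth0 _ hu0
    have f2 := orth0 _ hv0
    have f3 := orth _ ma _ huh
    have f4 := orth _ ma _ hvh
    have f5 := orth _ (m0 hu0) _ hvh
    have f6 := orth _ (m0 hv0) _ huh
    rw [hBs] at f6
    have f1' := f1
    rw [hBs] at f1'
    have f3' := f3
    rw [hBs] at f3'
    rw [mem_zero] at hu0 hv0
    rw [mem_adEigenspace] at huh hvh
    simp only [mul_add, mul_smul_comm, ha.idem, hu0, hv0, huh, hvh, map_add, map_smul,
      LinearMap.add_apply, LinearMap.smul_apply, f1', f2, f3', f4, f5, f6,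
      smul_eq_mul, add_zero, mul_zero, zero_add]
  refine ⟨B, ?_, hone⟩
  intro u v w
  rw [mul_comm u v]
  have hv : v ∈ Submodule.span F {a : A | IsPrimitiveAxis F a} := by rw [hspan]; trivial
  induction hv using Submodule.span_induction with
  | mem x hx => exact hadj x hx u w
  | zero => simp
  | add x y _ _ h1 h2 => simp only [add_mul, map_add, LinearMap.add_apply, h1, h2]
  | smul r x _ h => simp only [smul_mul_assoc, map_smul, LinearMap.smul_apply, h]

/-- A non-zero algebra of Jordan type half has exactly one normalized Frobenius form. -/
theorem existsUnique_frobeniusForm [NeZero (2 : F)] [Nontrivial A] {X : Set A}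
    (hX : IsJordanTypeHalf F X) : ∃! B : LinearMap.BilinForm F A, IsFrobeniusForm F X B := by
  obtain ⟨B, hassoc, hone⟩ := exists_assoc_form hX
  refine ⟨B, ⟨?_, hassoc, fun x hx => hone x (hX.axes x hx)⟩, ?_⟩
  · rintro rfl
    obtain ⟨x, hx⟩ : X.Nonempty := by
      rw [Set.nonempty_iff_ne_empty]
      rintro rfl
      have h := hX.generates
      rw [NonUnitalAlgebra.adjoin_empty] at h
      obtain ⟨y, hy⟩ := exists_ne (0 : A)
      have hy' : y ∈ (⊤ : NonUnitalSubalgebra F A) := trivial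
      rw [← h] at hy'
      exact hy (NonUnitalAlgebra.mem_bot.1 hy')
    have := hone x (hX.axes x hx)
    simp at this
  · intro B' hB'
    have key : ∀ C : LinearMap.BilinForm F A, (∀ u v w : A, C (u * v) w = C u (v * w)) →
        ∀ x : A, IsPrimitiveAxis F x → C x x = 1 → ∀ (r : F) (u0 uh : A),
        u0 ∈ adEigenspace F x 0 → uh ∈ adEigenspace F x (1 / 2) →
        C x (r • x + u0 + uh) = r := by
      intro C hC x hx h1 r u0 uh h0 hh
      have e0 : C x u0 = 0 := by
        have := hC x x u0
        rw [hx.idem, mem_zero.1 h0, map_zero] at this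
        exact this
      have eh : C x uh = 0 := by
        have h2 : (2 : F) ≠ 0 := NeZero.ne _
        have := hC x x uh
        rw [hx.idem, mem_adEigenspace.1 hh, map_smul, smul_eq_mul] at this
        field_simp at this
        linear_combination this
      simp [e0, eh, h1]
    ext u v
    have hu : u ∈ NonUnitalAlgebra.adjoin F X := by rw [hX.generates]; trivial
    induction hu using NonUnitalAlgebra.adjoin_induction generalizing v with
    | mem x hx =>
      have hx' := hX.axes x hx
      obtain ⟨r, v0, vh, rfl, h0, hh⟩ := hx'.decomp v
      rw [key B hassoc x hx' (hone x hx') r v0 vh h0 hh,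
        key B' hB'.assoc x hx' (hB'.normalized x hx) r v0 vh h0 hh]
    | add x y _ _ h1 h2 => simp only [map_add, LinearMap.add_apply, h1, h2]
    | zero => simp
    | mul x y _ _ h1 h2 => rw [hassoc, hB'.assoc, h1]
    | smul r x _ h => simp only [map_smul, LinearMap.smul_apply, h]

/-- The Frobenius form `(·, ·)` of the algebra `(A, X)` of Jordan type half. -/
noncomputable def frobeniusForm [NeZero (2 : F)] [Nontrivial A] {X : Set A}
    (hX : IsJordanTypeHalf F X) : LinearMap.BilinForm F A :=
  (existsUnique_frobeniusForm hX).choose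

theorem frobeniusForm_spec [NeZero (2 : F)] [Nontrivial A] {X : Set A}
    (hX : IsJordanTypeHalf F X) : IsFrobeniusForm F X (frobeniusForm hX) :=
  (existsUnique_frobeniusForm hX).choose_spec.1

end Existence

end JordanHalf

/-!
Write `J = ⟨⟨a, b⟩⟩`. For `(a, b) ∉ {0, 1}` it is a three-dimensional spin factor with basis
`i, p, q`, where `i` is the identity, `p² = i`, `pq = 0` and `q² = d i` (`exists_spinFrame`). Its
idempotents other than `0` and `i` are the points `c(x, y) = (i + x p + y q) / 2` of the conic
`x² + d y² = 1` (`IsSpinFrame.idempotent_eq`). The Frobenius form is non-degenerate on `J`, so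
`A = J ⊕ M` with `M = J^⊥` stable under multiplication by `J`.

If `c(x, y)` is a primitive axis then on `M` it has only the eigenvalues `0` and `1/2`, so that
`2 c(cm) = cm`, and its Miyamoto involution acts on `M` as the operator `m ↦ m - 4cm`, which is
linear in `c`. Both this identity and the multiplicativity of the involution on `M × M`, projected
to `M`, are therefore polynomial conditions of degree at most `2` in `(x, y)`. Modulo the equation
of the conic such a polynomial has the five coefficients of `1, x, y, xy, y²`. The axes
`a, b, b^τ(a), a^τ(b), a^τ(b)τ(a)` give five points of the conic, which are distinct unless
`(a, b) ∈ {0, 1/4, 1/2, 1}`; at `(a, b) = 1/2` the last two coincide. Vanishing at these points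
kills all coefficients except possibly, when `(a, b) = 1/2`, the one of `xy`
(`eq_zero_of_conic`). That last coefficient is eliminated separately, for every value of `(a, b)`,
by means of the relations already obtained (`IsSpinFrame.isSolidFrame`). So both conditions hold
at every point of the conic.

Conversely an idempotent `c` is a primitive axis as soon as `2 c(cu) - cu = (c, u) c` for all `u`
and its Miyamoto map is multiplicative (`isPrimitiveAxis_of_frobenius_proj`). On `J` both are
computations in the spin factor; on `M` they are the two conditions above, the `J`-component of
a product `uv` with `u, v ∈ M` being controlled by the associativity of the form
(`IsSolidFrame.isPrimitiveAxis_conicPoint`).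
-/

namespace JordanHalf

section SpinFrames

set_option linter.unusedSectionVars false

variable {F A : Type*} [Field F] [NonUnitalNonAssocCommRing A] [Module F A]
  [IsScalarTower F A A] [SMulCommClass F A A]

/-! ### Primitive axes and the Frobenius form -/

theorem symm_of_assoc [NeZero (2 : F)] {B : LinearMap.BilinForm F A} {X : Set A}
    (hX : IsJordanTypeHalf F X)
    (hB : ∀ u v w : A, B (u * v) w = B u (v * w)) (u v : A) : B u v = B v u := by
  have hu : u ∈ Submodule.span F {a : A | IsPrimitiveAxis F a} := by rw [hX.span_axes]; trivial
  induction hu using Submodule.span_induction with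
  | mem x hx =>
    have e : x * x = x := IsAxis.idem (IsPrimitiveAxis.toIsAxis hx)
    calc B x v = B (x * x) v := by rw [e]
      _ = B (v * x) x := by rw [hB, mul_comm x v, ← hB, mul_comm x v]
      _ = B v x := by rw [hB, e]
  | zero => simp
  | add x y _ _ h1 h2 => simp only [map_add, LinearMap.add_apply, h1, h2]
  | smul r x _ h => simp only [map_smul, LinearMap.smul_apply, h]

/-- The operator `2 L_c² - L_c` is the projection onto `A_1(c)`, whose coordinate is given by the
form. -/
theorem IsPrimitiveAxis.frobenius_proj [NeZero (2 : F)] {B : LinearMap.BilinForm F A}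
    (hB : ∀ u v w : A, B (u * v) w = B u (v * w)) {c : A} (hc : IsPrimitiveAxis F c)
    (h1 : B c c = 1) (u : A) : (2 : F) • (c * (c * u)) - c * u = B c u • c := by
  have h2 : (2 : F) ≠ 0 := NeZero.ne _
  obtain ⟨r, u0, uh, rfl, h0, hh⟩ := hc.decomp u
  rw [mem_zero] at h0
  rw [mem_adEigenspace] at hh
  have e0 : B c u0 = 0 := by
    have := hB c c u0
    rwa [hc.idem, h0, map_zero] at this
  have eh : B c uh = 0 := by
    have := hB c c uh
    rw [hc.idem, hh, map_smul, smul_eq_mul] at this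
    field_simp at this
    linear_combination this
  simp only [mul_add, mul_smul_comm, hc.idem, h0, hh, map_add, map_smul, e0, eh, h1, mul_zero]
  match_scalars <;> field_simp <;> norm_num

theorem tau_tau_of_frobenius_proj [NeZero (2 : F)] {B : LinearMap.BilinForm F A}
    (hB : ∀ u v w : A, B (u * v) w = B u (v * w)) {c : A} (hcc : c * c = c)
    (hproj : ∀ u, (2 : F) • (c * (c * u)) - c * u = B c u • c) (u : A) :
    tau (F := F) c (tau (F := F) c u) = u := by
  have ht : ∀ u, tau (F := F) c u = u - (4 : F) • (c * u) + (4 * B c u) • c := by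
    intro u
    rw [tau_apply]
    linear_combination (norm := module) (4 : F) • hproj u
  have hc : B c (c * u) = B c u := by rw [← hB, hcc]
  have h1 : B c c • c = c := by
    have := hproj c
    simp only [hcc] at this
    linear_combination (norm := module) -this
  rw [ht (tau c u), ht]
  simp only [mul_add, mul_sub, mul_smul_comm, hcc, map_add, map_sub, map_smul, hc, smul_eq_mul]
  linear_combination (norm := module) (8 : F) • hproj u + (16 * B c u) • h1

/-- A criterion for primitive axes. The projection identity yields semisimplicity and primitivity;
the fusion law is the `ℤ/2`-grading given by the Miyamoto map, except for `0 * 0 = {0}`, where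
the form shows that the product has no component along `c`. -/
theorem isPrimitiveAxis_of_frobenius_proj [NeZero (2 : F)] {B : LinearMap.BilinForm F A}
    (hB : ∀ u v w : A, B (u * v) w = B u (v * w)) {c : A} (h0 : c ≠ 0) (hcc : c * c = c)
    (hproj : ∀ u, (2 : F) • (c * (c * u)) - c * u = B c u • c)
    (hmul : ∀ u v, tau (F := F) c (u * v) = tau (F := F) c u * tau (F := F) c v) :
    IsPrimitiveAxis F c := by
  have h2 : (2 : F) ≠ 0 := NeZero.ne _
  have h4 : (4 : F) ≠ 0 := by
    have : (4 : F) = 2 * 2 := by norm_num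
    rw [this]; exact mul_ne_zero h2 h2
  have h8 : (8 : F) ≠ 0 := by
    have : (8 : F) = 2 * 4 := by norm_num
    rw [this]; exact mul_ne_zero h2 h4
  have hcubic : ∀ u, (2 : F) • (c * (c * (c * u))) = (3 : F) • (c * (c * u)) - c * u := by
    intro u
    have h : c * ((2 : F) • (c * (c * u)) - c * u) = (2 : F) • (c * (c * u)) - c * u := by
      rw [hproj, mul_smul_comm, hcc]
    rw [mul_sub, mul_smul_comm] at h
    linear_combination (norm := module) h
  have hone : ∀ u ∈ adEigenspace F c 1, u = B c u • c := by
    intro u hu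
    rw [mem_adEigenspace, one_smul] at hu
    have := hproj u
    rw [hu, hu] at this
    rw [← this]; module
  have hc1 : c ∈ adEigenspace F c 1 := by simp [mem_adEigenspace, hcc]
  have m1 : ∀ u, (2 : F) • (c * (c * u)) - c * u ∈ adEigenspace F c 1 := by
    intro u
    rw [hproj]; exact Submodule.smul_mem _ _ hc1
  have m0 : ∀ u, u - (3 : F) • (c * u) + (2 : F) • (c * (c * u)) ∈ adEigenspace F c 0 := by
    intro u
    rw [mem_zero]
    simp only [mul_add, mul_sub, mul_smul_comm, hcubic]
    module
  have mh : ∀ u, (4 : F) • (c * u - c * (c * u)) ∈ adEigenspace F c (1 / 2) := by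
    intro u
    rw [mem_adEigenspace]
    simp only [mul_sub, mul_smul_comm]
    have h := hcubic u
    have e : c * (c * (c * u)) = (1 / 2 : F) • ((3 : F) • (c * (c * u)) - c * u) := by
      rw [← h, smul_smul]; simp [h2]
    rw [e]
    match_scalars <;> field_simp <;> norm_num
  have hplus : ∀ u, tau (F := F) c u = u →
      u ∈ adEigenspace F c 1 ⊔ adEigenspace F c 0 ∧ c * (c * u) = c * u := by
    intro u hu
    rw [tau_apply, sub_eq_self, smul_eq_zero_iff_right h8, sub_eq_zero] at hu
    refine ⟨?_, hu.symm⟩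
    have e : u = ((2 : F) • (c * (c * u)) - c * u)
        + (u - (3 : F) • (c * u) + (2 : F) • (c * (c * u))) := by
      rw [← hu]; module
    rw [e]
    exact Submodule.add_mem_sup (m1 u) (m0 u)
  have hhalf : ∀ u, tau (F := F) c u = -u → u ∈ adEigenspace F c (1 / 2) := by
    intro u hu
    rw [tau_apply] at hu
    have e : u = (4 : F) • (c * u - c * (c * u)) := by
      have : (2 : F) • u = (2 : F) • ((4 : F) • (c * u - c * (c * u))) := by
        linear_combination (norm := module) hu
      exact smul_right_injective A h2 this
    rw [e]; exact mh u
  have t0 : ∀ {u}, u ∈ adEigenspace F c 0 → tau (F := F) c u = u := fun hu =>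
    tau_plus (Submodule.mem_sup_right hu)
  refine { ne_zero := h0, idem := hcc, semisimple := ?_, one_one := ?_, one_zero := ?_,
           zero_zero := ?_, one_half := ?_, zero_half := ?_, half_half := ?_, primitive := ?_ }
  · rw [eq_top_iff]
    intro u _
    have e : u = ((2 : F) • (c * (c * u)) - c * u)
        + (u - (3 : F) • (c * u) + (2 : F) • (c * (c * u)))
        + (4 : F) • (c * u - c * (c * u)) := by module
    rw [e]
    exact Submodule.add_mem_sup (Submodule.add_mem_sup (m1 u) (m0 u)) (mh u)
  · intro x hx y hy
    rw [hone x hx, hone y hy, smul_mul_smul_comm, hcc]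
    exact Submodule.smul_mem _ _ hc1
  · intro x hx y hy
    rw [hone x hx, smul_mul_assoc, mem_zero.1 hy, smul_zero]
  · intro x hx y hy
    obtain ⟨-, h⟩ := hplus (x * y) (by rw [hmul, t0 hx, t0 hy])
    have hz : B c (x * y) = 0 := by rw [← hB, mem_zero.1 hx]; simp
    have := hproj (x * y)
    rw [h, hz] at this
    rw [mem_zero]
    linear_combination (norm := module) this
  · intro x hx y hy
    rw [hone x hx, smul_mul_assoc, mem_adEigenspace.1 hy]
    exact Submodule.smul_mem _ _ (Submodule.smul_mem _ _ hy)
  · intro x hx y hy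
    exact hhalf _ (by rw [hmul, t0 hx, tau_half hy, mul_neg])
  · intro x hx y hy
    exact (hplus _ (by rw [hmul, tau_half hx, tau_half hy, neg_mul_neg])).1
  · refine le_antisymm (fun u hu => ?_) ?_
    · exact Submodule.mem_span_singleton.2 ⟨_, (hone u hu).symm⟩
    · rw [Submodule.span_singleton_le_iff_mem]; exact hc1

/-! ### Interpolation on a conic -/

/-- A polynomial `k₀ + X k₁ + Y k₂ + XY k₃ + Y² k₄` with vector coefficients that vanishes at the
points `(1, 0)`, `(x, ±1)`, `(2x² - 1, ±2x)` has `k₀ = k₁ = k₂ = k₄ = 0`. When `x = 0` the last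
two points coincide and `k₃` is not determined. -/
theorem eq_zero_of_conic [NeZero (2 : F)] {V : Type*} [AddCommGroup V] [Module F V] {x : F}
    (hx1 : x ≠ 1) (hx2 : 1 + 2 * x ≠ 0) {k₀ k₁ k₂ k₃ k₄ : V}
    (e0 : k₀ + k₁ = 0)
    (e1 : k₀ + x • k₁ + k₂ + x • k₃ + k₄ = 0)
    (e1' : k₀ + x • k₁ - k₂ - x • k₃ + k₄ = 0)
    (e2 : k₀ + (2 * x ^ 2 - 1) • k₁ + (2 * x) • k₂ + ((2 * x ^ 2 - 1) * (2 * x)) • k₃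
      + (2 * x) ^ 2 • k₄ = 0)
    (e2' : k₀ + (2 * x ^ 2 - 1) • k₁ - (2 * x) • k₂ - ((2 * x ^ 2 - 1) * (2 * x)) • k₃
      + (2 * x) ^ 2 • k₄ = 0) :
    k₀ = 0 ∧ k₁ = 0 ∧ k₂ = 0 ∧ k₄ = 0 := by
  have h2 : (2 : F) ≠ 0 := NeZero.ne _
  have hx1' : x - 1 ≠ 0 := sub_ne_zero.2 hx1
  -- Sums and differences over `Y ↦ -Y` separate `k₀, k₁, k₄` from `k₂, k₃`.
  have z0 : (2 * (2 * (x - 1) ^ 2 * (1 + 2 * x))) • k₀ = 0 := by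
    linear_combination (norm := module) e2 + e2' - (4 * x ^ 2) • (e1 + e1')
      - (2 * (2 * x ^ 2 - 1) - 8 * x ^ 3) • e0
  have k0 : k₀ = 0 := by
    refine (smul_eq_zero_iff_right ?_).1 z0
    exact mul_ne_zero h2 (mul_ne_zero (mul_ne_zero h2 (pow_ne_zero _ hx1')) hx2)
  have k1 : k₁ = 0 := by rw [k0, zero_add] at e0; exact e0
  subst k0 k1
  have k4 : k₄ = 0 := by
    refine (smul_eq_zero_iff_right h2).1 ?_
    linear_combination (norm := module) e1 + e1'
  subst k4
  have h23 : k₂ = -(x • k₃) := by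
    have : (2 : F) • (k₂ + x • k₃) = 0 := by linear_combination (norm := module) e1 - e1'
    rw [smul_eq_zero_iff_right h2] at this
    exact eq_neg_of_add_eq_zero_left this
  have z3 : (2 * ((x - 1) * (1 + 2 * x)) * 2) • (x • k₃) = 0 := by
    rw [h23] at e2 e2'
    linear_combination (norm := module) e2 - e2'
  rw [smul_eq_zero_iff_right (mul_ne_zero (mul_ne_zero h2 (mul_ne_zero hx1' hx2)) h2)] at z3
  exact ⟨rfl, rfl, by rw [h23, z3, neg_zero], rfl⟩

/-! ### Spin frames and the conic of idempotents -/

/-- `i, p, q` multiply as the standard basis of a spin factor: `i` is the identity of their span,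
and `p, q` are orthogonal vectors of norms `1` and `d` for the quadratic form of the spin factor.
The associating form `B` is normalized to `B i i = 2`, so that its remaining values on the span
follow. -/
structure IsSpinFrame (B : LinearMap.BilinForm F A) (i p q : A) (d : F) : Prop where
  assoc : ∀ u v w : A, B (u * v) w = B u (v * w)
  symm : ∀ u v : A, B u v = B v u
  ii : i * i = i
  ip : i * p = p
  iq : i * q = q
  pp : p * p = i
  pq : p * q = 0
  qq : q * q = d • i
  form_ii : B i i = 2
  form_ip : B i p = 0
  form_iq : B i q = 0
  d_ne_zero : d ≠ 0

/-- The element `(i + x p + y q) / 2`, which is idempotent if `x² + d y² = 1`. -/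
def conicPoint (i p q : A) (x y : F) : A := (1 / 2 : F) • (i + x • p + y • q)

/-- The orthogonal complement of the span of `i, p, q` with respect to `B`. -/
def framePerp (B : LinearMap.BilinForm F A) (i p q : A) : Submodule F A :=
  LinearMap.ker (B i) ⊓ LinearMap.ker (B p) ⊓ LinearMap.ker (B q)

/-- The orthogonal projection onto `framePerp B i p q`, for a spin frame with `q² = d i`. -/
def perpProj (B : LinearMap.BilinForm F A) (i p q : A) (d : F) : A →ₗ[F] A :=
  LinearMap.id - (1 / 2 : F) • ((B i).smulRight i + (B p).smulRight p
    + d⁻¹ • (B q).smulRight q)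

theorem mem_framePerp {B : LinearMap.BilinForm F A} {i p q m : A} :
    m ∈ framePerp B i p q ↔ B i m = 0 ∧ B p m = 0 ∧ B q m = 0 := by
  simp [framePerp, and_assoc]

theorem perpProj_apply (B : LinearMap.BilinForm F A) (i p q : A) (d : F) (u : A) :
    perpProj B i p q d u
      = u - (1 / 2 : F) • (B i u • i + B p u • p + d⁻¹ • B q u • q) := by
  simp [perpProj]

namespace IsSpinFrame

variable {B : LinearMap.BilinForm F A} {i p q : A} {d : F}

theorem pi (h : IsSpinFrame B i p q d) : p * i = p := by rw [mul_comm, h.ip]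
theorem qi (h : IsSpinFrame B i p q d) : q * i = q := by rw [mul_comm, h.iq]
theorem qp (h : IsSpinFrame B i p q d) : q * p = 0 := by rw [mul_comm, h.pq]

theorem form_pi (h : IsSpinFrame B i p q d) : B p i = 0 := by rw [h.symm, h.form_ip]
theorem form_qi (h : IsSpinFrame B i p q d) : B q i = 0 := by rw [h.symm, h.form_iq]
theorem form_pp (h : IsSpinFrame B i p q d) : B p p = 2 := by
  rw [← h.form_ii, ← h.pp, ← h.assoc, h.pp, h.ip]
theorem form_pq (h : IsSpinFrame B i p q d) : B p q = 0 := by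
  rw [← h.ip, h.assoc, h.pq, map_zero]
theorem form_qp (h : IsSpinFrame B i p q d) : B q p = 0 := by rw [h.symm, h.form_pq]
theorem form_qq (h : IsSpinFrame B i p q d) : B q q = 2 * d := by
  calc B q q = B (i * q) q := by rw [h.iq]
    _ = 2 * d := by rw [h.assoc, h.qq, map_smul, h.form_ii, smul_eq_mul, mul_comm]

theorem form_mul (h : IsSpinFrame B i p q d) (u v w : A) : B u (v * w) = B (v * u) w := by
  rw [← h.assoc, mul_comm]

section Perp

theorem mul_mem (h : IsSpinFrame B i p q d) {m : A} (hm : m ∈ framePerp B i p q) :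
    i * m ∈ framePerp B i p q ∧ p * m ∈ framePerp B i p q ∧ q * m ∈ framePerp B i p q := by
  obtain ⟨h1, h2, h3⟩ := mem_framePerp.1 hm
  simp [mem_framePerp, h.form_mul, h.ii, h.ip, h.iq, h.pi, h.pp, h.pq, h.qi, h.qp, h.qq, h1, h2, h3]

theorem conicPoint_mul_mem (h : IsSpinFrame B i p q d) (x y : F) {m : A}
    (hm : m ∈ framePerp B i p q) : conicPoint i p q x y * m ∈ framePerp B i p q := by
  obtain ⟨h1, h2, h3⟩ := h.mul_mem hm
  simp only [conicPoint, add_mul, smul_mul_assoc]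
  exact Submodule.smul_mem _ _ (add_mem (add_mem h1 (Submodule.smul_mem _ _ h2))
    (Submodule.smul_mem _ _ h3))

variable [NeZero (2 : F)]

theorem perpProj_mem (h : IsSpinFrame B i p q d) (u : A) :
    perpProj B i p q d u ∈ framePerp B i p q := by
  have h2 : (2 : F) ≠ 0 := NeZero.ne _
  have hd := h.d_ne_zero
  simp only [mem_framePerp, perpProj_apply, map_sub, map_smul, map_add, h.form_ii, h.form_ip,
    h.form_iq, h.form_pi, h.form_pp, h.form_pq, h.form_qi, h.form_qp, h.form_qq, smul_eq_mul]
  refine ⟨?_, ?_, ?_⟩ <;> field_simp <;> ring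

theorem exists_decomp (h : IsSpinFrame B i p q d) (u : A) :
    ∃ (r s t : F) (m : A), m ∈ framePerp B i p q ∧ u = r • i + s • p + t • q + m := by
  refine ⟨1 / 2 * B i u, 1 / 2 * B p u, 1 / 2 * d⁻¹ * B q u, _, h.perpProj_mem u, ?_⟩
  rw [perpProj_apply]; module

theorem perpProj_eq_self {m : A} (hm : m ∈ framePerp B i p q) : perpProj B i p q d m = m := by
  obtain ⟨h1, h2, h3⟩ := mem_framePerp.1 hm
  simp [perpProj_apply, h1, h2, h3]

theorem eq_zero_of_perpProj {u : A} (hu : perpProj B i p q d u = 0)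
    (hu' : u ∈ framePerp B i p q) : u = 0 := by
  rw [← hu, perpProj_eq_self hu']

theorem mul_perpProj (h : IsSpinFrame B i p q d) (u : A) :
    i * perpProj B i p q d u = perpProj B i p q d (i * u) ∧
    p * perpProj B i p q d u = perpProj B i p q d (p * u) ∧
    q * perpProj B i p q d u = perpProj B i p q d (q * u) := by
  have hd := h.d_ne_zero
  simp only [perpProj_apply, h.form_mul, mul_sub, mul_add, mul_smul_comm, h.ii, h.ip, h.iq,
    h.pi, h.pp, h.pq, h.qi, h.qp, h.qq, map_zero, map_smul, LinearMap.zero_apply,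
    LinearMap.smul_apply, smul_eq_mul, true_and]
  refine ⟨?_, ?_⟩ <;> match_scalars <;> first | ring1 | field_simp

end Perp

section Conic

variable [NeZero (2 : F)] {x y : F}

theorem conicPoint_mul_self (h : IsSpinFrame B i p q d) (hxy : x ^ 2 + d * y ^ 2 = 1) :
    conicPoint i p q x y * conicPoint i p q x y = conicPoint i p q x y := by
  have h2 : (2 : F) ≠ 0 := NeZero.ne _
  simp only [conicPoint, mul_add, add_mul, mul_smul_comm, smul_mul_assoc, h.ii, h.ip, h.iq,
    h.pi, h.pp, h.pq, h.qi, h.qp, h.qq]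
  match_scalars <;> field_simp <;> grind

theorem conicPoint_ne_zero (h : IsSpinFrame B i p q d) (x y : F) : conicPoint i p q x y ≠ 0 := by
  have h2 : (2 : F) ≠ 0 := NeZero.ne _
  intro hc
  have := congrArg (B i) hc
  simp [conicPoint, h.form_ii, h.form_ip, h.form_iq, h2] at this

/-- On a spin frame the Miyamoto map of the point `(x, y)` of the conic is the reflection that fixes
`i` and `x p + y q`. -/
theorem tau_frame (h : IsSpinFrame B i p q d) (hxy : x ^ 2 + d * y ^ 2 = 1) :
    tau (F := F) (conicPoint i p q x y) i = i ∧
    tau (F := F) (conicPoint i p q x y) p = (2 * x) • (x • p + y • q) - p ∧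
    tau (F := F) (conicPoint i p q x y) q = (2 * d * y) • (x • p + y • q) - q := by
  have h2 : (2 : F) ≠ 0 := NeZero.ne _
  simp only [tau_apply, conicPoint, mul_add, add_mul, mul_smul_comm, smul_mul_assoc, h.ii, h.ip,
    h.iq, h.pi, h.pp, h.pq, h.qi, h.qp, h.qq, smul_add, smul_zero, mul_zero]
  refine ⟨?_, ?_, ?_⟩ <;> match_scalars <;> field_simp <;> first | ring1 | grind

theorem tau_conicPoint (h : IsSpinFrame B i p q d) (hxy : x ^ 2 + d * y ^ 2 = 1) (z w : F) :
    tau (F := F) (conicPoint i p q x y) (conicPoint i p q z w)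
      = conicPoint i p q (2 * x * (x * z + d * y * w) - z) (2 * y * (x * z + d * y * w) - w) := by
  obtain ⟨h1, h2, h3⟩ := h.tau_frame hxy
  conv_lhs => rw [conicPoint.eq_1 i p q z w]
  simp only [map_smul, map_add, h1, h2, h3]
  rw [conicPoint]
  match_scalars <;> ring

theorem form_conicPoint_self (h : IsSpinFrame B i p q d) (hxy : x ^ 2 + d * y ^ 2 = 1) :
    B (conicPoint i p q x y) (conicPoint i p q x y) = 1 := by
  have h2 : (2 : F) ≠ 0 := NeZero.ne _
  simp only [conicPoint, map_smul, map_add, LinearMap.smul_apply, LinearMap.add_apply, h.form_ii,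
    h.form_ip, h.form_iq, h.form_pi, h.form_pp, h.form_pq, h.form_qi, h.form_qp, h.form_qq,
    smul_eq_mul]
  field_simp
  linear_combination 2 * hxy

theorem conicPoint_proj_frame (h : IsSpinFrame B i p q d) (hxy : x ^ 2 + d * y ^ 2 = 1)
    (r s t : F) :
    let c := conicPoint i p q x y
    let u := r • i + s • p + t • q
    (2 : F) • (c * (c * u)) - c * u = B c u • c := by
  have h2 : (2 : F) ≠ 0 := NeZero.ne _
  simp only [conicPoint, mul_add, add_mul, mul_smul_comm, smul_mul_assoc, h.ii, h.ip, h.iq,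
    h.pi, h.pp, h.pq, h.qi, h.qp, h.qq, smul_add, smul_zero, mul_zero, map_smul, map_add,
    LinearMap.smul_apply, LinearMap.add_apply, h.form_ii,
    h.form_ip, h.form_iq, h.form_pi, h.form_pp, h.form_pq, h.form_qi, h.form_qp, h.form_qq,
    smul_eq_mul]
  match_scalars <;> field_simp <;> grind

theorem tau_mul_frame (h : IsSpinFrame B i p q d) (hxy : x ^ 2 + d * y ^ 2 = 1)
    (r s t r' s' t' : F) :
    let c := conicPoint i p q x y
    let u := r • i + s • p + t • q
    let v := r' • i + s' • p + t' • q
    tau (F := F) c (u * v) = tau (F := F) c u * tau (F := F) c v := by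
  obtain ⟨h1, h2, h3⟩ := h.tau_frame hxy
  simp only [mul_add, add_mul, mul_sub, sub_mul, mul_smul_comm, smul_mul_assoc, h.ii, h.ip, h.iq,
    h.pi, h.pp, h.pq, h.qi, h.qp, h.qq, smul_add, smul_zero, map_smul, map_add, map_zero,
    h1, h2, h3]
  match_scalars <;> grind

end Conic

end IsSpinFrame

/-! ### The orthogonal complement of a frame -/

/-- The operator `1 - 2 L_i`, which acts as `1`, `0`, `-1` on the eigenvectors of `L_i` for the
eigenvalues `0`, `1/2`, `1`. -/
def peirceSign (i : A) : A →ₗ[F] A := LinearMap.id - (2 : F) • LinearMap.mul F A i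

theorem peirceSign_apply (i u : A) : peirceSign (F := F) i u = u - (2 : F) • (i * u) := by
  simp [peirceSign]

/-- A spin frame for which the point `(x, y)` of the conic satisfies, identically in `(x, y)`, the
two conditions on `M = framePerp B i p q` met by primitive axes: `2 c(cm) = cm`, and the
Miyamoto map is multiplicative on `M × M` modulo the span of the frame. The fields are the
coefficients of these conditions as polynomials in `x, y`, written with `1 - 2 L_i`. -/
structure IsSolidFrame (B : LinearMap.BilinForm F A) (i p q : A) (d : F) : Prop
    extends IsSpinFrame B i p q d where
  sign_p : ∀ m ∈ framePerp B i p q, peirceSign (F := F) i (p * m) = 0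
  p_sign : ∀ m ∈ framePerp B i p q, p * peirceSign (F := F) i m = 0
  sign_q : ∀ m ∈ framePerp B i p q, peirceSign (F := F) i (q * m) = 0
  q_sign : ∀ m ∈ framePerp B i p q, q * peirceSign (F := F) i m = 0
  sign_sign : ∀ m ∈ framePerp B i p q,
    peirceSign (F := F) i (peirceSign (F := F) i m) = m - (4 : F) • (p * (p * m))
  q_q : ∀ m ∈ framePerp B i p q, q * (q * m) = d • (p * (p * m))
  q_p : ∀ m ∈ framePerp B i p q, q * (p * m) = -(p * (q * m))
  sign_mul : ∀ u ∈ framePerp B i p q, ∀ v ∈ framePerp B i p q, perpProj B i p q d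
    (peirceSign (F := F) i (u * v)) = perpProj B i p q d
      (peirceSign (F := F) i u * peirceSign (F := F) i v + (4 : F) • ((p * u) * (p * v)))
  p_mul : ∀ u ∈ framePerp B i p q, ∀ v ∈ framePerp B i p q, perpProj B i p q d (p * (u * v))
    = perpProj B i p q d ((p * u) * peirceSign (F := F) i v
        + peirceSign (F := F) i u * (p * v))
  q_mul : ∀ u ∈ framePerp B i p q, ∀ v ∈ framePerp B i p q, perpProj B i p q d (q * (u * v))
    = perpProj B i p q d ((q * u) * peirceSign (F := F) i v
        + peirceSign (F := F) i u * (q * v))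
  q_mul_q : ∀ u ∈ framePerp B i p q, ∀ v ∈ framePerp B i p q,
    perpProj B i p q d ((q * u) * (q * v)) = d • perpProj B i p q d ((p * u) * (p * v))
  p_mul_q : ∀ u ∈ framePerp B i p q, ∀ v ∈ framePerp B i p q,
    perpProj B i p q d ((p * u) * (q * v) + (q * u) * (p * v)) = 0

namespace IsSpinFrame

variable {B : LinearMap.BilinForm F A} {i p q : A} {d : F} [NeZero (2 : F)] {x y : F}

theorem two_smul_conicPoint (i p q : A) (x y : F) :
    (2 : F) • conicPoint i p q x y = i + x • p + y • q := by
  rw [conicPoint, smul_smul, mul_one_div_cancel (NeZero.ne (2 : F)), one_smul]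

theorem form_conicPoint_perp (x y : F) {m : A} (hm : m ∈ framePerp B i p q) :
    B (conicPoint i p q x y) m = 0 := by
  obtain ⟨h1, h2, h3⟩ := mem_framePerp.1 hm
  simp [conicPoint, h1, h2, h3]

/-- The identity `2 c(cm) = cm` for `c = c(x, y)`, as a polynomial in the
coordinates of the point. -/
theorem conic_sq (hxy : x ^ 2 + d * y ^ 2 = 1)
    {m : A} (hc : (2 : F) • (conicPoint i p q x y * (conicPoint i p q x y * m))
      = conicPoint i p q x y * m) :
    (i * (i * m) - i * m + p * (p * m)) + x • (i * (p * m) + p * (i * m) - p * m)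
      + y • (i * (q * m) + q * (i * m) - q * m) + (x * y) • (p * (q * m) + q * (p * m))
      + y ^ 2 • (q * (q * m) - d • (p * (p * m))) = 0 := by
  have e : (i + x • p + y • q) * ((i + x • p + y • q) * m) = (i + x • p + y • q) * m := by
    rw [← two_smul_conicPoint]
    simp only [smul_mul_assoc, mul_smul_comm]
    rw [hc]
  simp only [add_mul, mul_add, smul_mul_assoc, mul_smul_comm] at e
  linear_combination (norm := module) e - hxy • (p * (p * m))

theorem two_smul_axis_mul_mul (h : IsSpinFrame B i p q d) (hxy : x ^ 2 + d * y ^ 2 = 1)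
    (hc : IsPrimitiveAxis F (conicPoint i p q x y)) {m : A} (hm : m ∈ framePerp B i p q) :
    (2 : F) • (conicPoint i p q x y * (conicPoint i p q x y * m)) = conicPoint i p q x y * m := by
  have := hc.frobenius_proj h.assoc (h.form_conicPoint_self hxy) m
  rwa [form_conicPoint_perp x y hm, zero_smul, sub_eq_zero] at this

/-- Where `2 c(cm) = cm`, the Miyamoto map is `m ↦ m - 4cm`, hence linear in `c`. -/
theorem tau_perp {m : A} (hm : (2 : F) • (conicPoint i p q x y * (conicPoint i p q x y * m))
      = conicPoint i p q x y * m) :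
    tau (F := F) (conicPoint i p q x y) m
      = peirceSign (F := F) i m - (2 : F) • (x • (p * m) + y • (q * m)) := by
  have e : tau (F := F) (conicPoint i p q x y) m
      = m - (2 : F) • (((2 : F) • conicPoint i p q x y) * m) := by
    rw [tau_apply, smul_mul_assoc]
    linear_combination (norm := module) (4 : F) • hm
  rw [e, two_smul_conicPoint, peirceSign_apply]
  simp only [add_mul, smul_mul_assoc]
  module

theorem perpProj_conicPoint_mul (h : IsSpinFrame B i p q d) (x y : F) (u : A) :
    conicPoint i p q x y * perpProj B i p q d u
      = perpProj B i p q d (conicPoint i p q x y * u) := by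
  obtain ⟨h1, h2, h3⟩ := h.mul_perpProj u
  simp only [conicPoint, add_mul, smul_mul_assoc, map_add, map_smul, h1, h2, h3]

theorem perpProj_tau (h : IsSpinFrame B i p q d) (x y : F) (u : A) :
    perpProj B i p q d (tau (F := F) (conicPoint i p q x y) u)
      = tau (F := F) (conicPoint i p q x y) (perpProj B i p q d u) := by
  simp only [tau_apply, h.perpProj_conicPoint_mul, map_sub, map_smul]

theorem perpProj_peirceSign (h : IsSpinFrame B i p q d) (u : A) :
    perpProj B i p q d (peirceSign (F := F) i u)
      = peirceSign (F := F) i (perpProj B i p q d u) := by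
  simp only [peirceSign_apply, (h.mul_perpProj u).1, map_sub, map_smul]

/-- The multiplicativity of the Miyamoto involution of `c(x, y)` on `M × M`, projected to
`M = framePerp B i p q`, as a polynomial in the coordinates of the point. -/
theorem conic_tau_mul (h : IsSpinFrame B i p q d) (hxy : x ^ 2 + d * y ^ 2 = 1)
    (hc : IsPrimitiveAxis F (conicPoint i p q x y)) {u v : A} (hu : u ∈ framePerp B i p q)
    (hv : v ∈ framePerp B i p q) :
    let K := peirceSign (F := F) i
    let P := perpProj B i p q d
    P (K (u * v) - K u * K v - (4 : F) • ((p * u) * (p * v)))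
      + x • P ((-2 : F) • (p * (u * v) - (p * u) * K v - K u * (p * v)))
      + y • P ((-2 : F) • (q * (u * v) - (q * u) * K v - K u * (q * v)))
      + (x * y) • P ((-4 : F) • ((p * u) * (q * v) + (q * u) * (p * v)))
      + y ^ 2 • P ((-4 : F) • ((q * u) * (q * v) - d • ((p * u) * (p * v)))) = 0 := by
  intro K P
  have e := congrArg P (hc.toIsAxis.tau_mul u v)
  rw [tau_perp (h.two_smul_axis_mul_mul hxy hc hu), tau_perp (h.two_smul_axis_mul_mul hxy hc hv),
    h.perpProj_tau, tau_perp (h.two_smul_axis_mul_mul hxy hc (h.perpProj_mem _)),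
    ← h.perpProj_peirceSign, (h.mul_perpProj _).2.1, (h.mul_perpProj _).2.2] at e
  change P (K (u * v)) - (2 : F) • (x • P _ + y • P _)
    = P ((K u - (2 : F) • (x • (p * u) + y • (q * u))) * (K v - _)) at e
  simp only [sub_mul, mul_sub, add_mul, mul_add, smul_mul_assoc, mul_smul_comm, map_add, map_sub,
    map_smul] at e ⊢
  linear_combination (norm := module) e + (4 * hxy) • (P ((p * u) * (p * v)))

/-- Two primitive axes `c(1, 0)` and `c(x, 1)` generate, through their Miyamoto involutions, enough
axes to make the frame solid. -/
theorem isSolidFrame (h : IsSpinFrame B i p q d) (hd : x ^ 2 + d = 1) (hx1 : x ≠ 1)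
    (hx2 : 1 + 2 * x ≠ 0) (h0 : IsPrimitiveAxis F (conicPoint i p q (1 : F) 0))
    (h1 : IsPrimitiveAxis F (conicPoint i p q x 1)) : IsSolidFrame B i p q d := by
  have g0 : (1 : F) ^ 2 + d * 0 ^ 2 = 1 := by ring
  have g1 : x ^ 2 + d * 1 ^ 2 = 1 := by linear_combination hd
  have g1' : x ^ 2 + d * (-1) ^ 2 = 1 := by linear_combination hd
  have g2 : (2 * x ^ 2 - 1) ^ 2 + d * (2 * x) ^ 2 = 1 := by linear_combination 4 * x ^ 2 * hd
  have g2' : (2 * x ^ 2 - 1) ^ 2 + d * (-(2 * x)) ^ 2 = 1 := by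
    linear_combination 4 * x ^ 2 * hd
  have h1' : IsPrimitiveAxis F (conicPoint i p q x (-1)) := by
    have := h0.tau h1
    rw [h.tau_conicPoint g0] at this
    convert this using 2 <;> ring
  have h2 : IsPrimitiveAxis F (conicPoint i p q (2 * x ^ 2 - 1) (2 * x)) := by
    have := h1.tau h0
    rw [h.tau_conicPoint g1] at this
    convert this using 2 <;> ring
  have h2' : IsPrimitiveAxis F (conicPoint i p q (2 * x ^ 2 - 1) (-(2 * x))) := by
    have := h0.tau h2
    rw [h.tau_conicPoint g0] at this
    convert this using 2 <;> ring
  set M := framePerp B i p q with hM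
  set P := perpProj B i p q d with hP
  set K := peirceSign (F := F) i with hK
  have hKa : ∀ u, K u = u - (2 : F) • (i * u) := peirceSign_apply i
  -- `i = c + (i - c)` lies in `A_1(c) ⊕ A_0(c)`, so `L_i` commutes with `L_c`.
  have hseress : ∀ {z w : F}, z ^ 2 + d * w ^ 2 = 1 → IsPrimitiveAxis F (conicPoint i p q z w) →
      ∀ m, conicPoint i p q z w * (i * m) = i * (conicPoint i p q z w * m) := by
    intro z w g hc m
    have e := IsAxis.seress hc m (w := i) ?_
    · rw [mul_comm i m, e, mul_comm]
    · have e1 : conicPoint i p q z w * i = conicPoint i p q z w := by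
        simp only [conicPoint, add_mul, smul_mul_assoc, h.ii, h.pi, h.qi]
      have e0 : i - conicPoint i p q z w ∈ adEigenspace F (conicPoint i p q z w) 0 := by
        rw [mem_zero, mul_sub, e1, hc.idem, sub_self]
      have := Submodule.add_mem_sup (self_mem_one hc.toIsAxis) e0
      rwa [add_sub_cancel] at this
  have cp : ∀ m, p * (i * m) = i * (p * m) := by
    intro m
    have e : ((2 : F) • conicPoint i p q (1 : F) 0) * (i * m)
        = i * (((2 : F) • conicPoint i p q (1 : F) 0) * m) := by
      rw [smul_mul_assoc, smul_mul_assoc, mul_smul_comm, hseress g0 h0]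
    rw [two_smul_conicPoint] at e
    simpa [mul_add, add_mul] using e
  have cq : ∀ m, q * (i * m) = i * (q * m) := by
    intro m
    have e : ((2 : F) • conicPoint i p q x 1) * (i * m)
        = i * (((2 : F) • conicPoint i p q x 1) * m) := by
      rw [smul_mul_assoc, smul_mul_assoc, mul_smul_comm, hseress g1 h1]
    rw [two_smul_conicPoint] at e
    simpa [mul_add, add_mul, smul_mul_assoc, mul_smul_comm, cp] using e
  have lin : ∀ m ∈ M, i * (i * m) - i * m + p * (p * m) = 0 ∧
      i * (p * m) + p * (i * m) - p * m = 0 ∧ i * (q * m) + q * (i * m) - q * m = 0 ∧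
      q * (q * m) - d • (p * (p * m)) = 0 := by
    intro m hm
    have k0 := conic_sq g0 (h.two_smul_axis_mul_mul g0 h0 hm)
    have k1 := conic_sq g1 (h.two_smul_axis_mul_mul g1 h1 hm)
    have k1' := conic_sq g1' (h.two_smul_axis_mul_mul g1' h1' hm)
    have k2 := conic_sq g2 (h.two_smul_axis_mul_mul g2 h2 hm)
    have k2' := conic_sq g2' (h.two_smul_axis_mul_mul g2' h2' hm)
    refine eq_zero_of_conic hx1 hx2 ?_ ?_ ?_ ?_ ?_ (k₃ := p * (q * m) + q * (p * m))
    · linear_combination (norm := module) k0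
    · linear_combination (norm := module) k1
    · linear_combination (norm := module) k1'
    · linear_combination (norm := module) k2
    · linear_combination (norm := module) k2'
  have Kp : ∀ m ∈ M, K (p * m) = 0 := by
    intro m hm
    have := (lin m hm).2.1
    rw [cp] at this
    rw [hKa]
    linear_combination (norm := module) -this
  have Kq : ∀ m ∈ M, K (q * m) = 0 := by
    intro m hm
    have := (lin m hm).2.2.1
    rw [cq] at this
    rw [hKa]
    linear_combination (norm := module) -this
  have pK : ∀ m ∈ M, p * K m = 0 := by
    intro m hm
    rw [← Kp m hm, hKa, hKa, mul_sub, mul_smul_comm, cp]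
  have qK : ∀ m ∈ M, q * K m = 0 := by
    intro m hm
    rw [← Kq m hm, hKa, hKa, mul_sub, mul_smul_comm, cq]
  have KK : ∀ m ∈ M, K (K m) = m - (4 : F) • (p * (p * m)) := by
    intro m hm
    have := (lin m hm).1
    simp only [hKa, mul_sub, mul_smul_comm]
    linear_combination (norm := module) (4 : F) • this
  have qq : ∀ m ∈ M, q * (q * m) = d • (p * (p * m)) := fun m hm => sub_eq_zero.1 (lin m hm).2.2.2
  have qp : ∀ m ∈ M, q * (p * m) = -(p * (q * m)) := by
    intro m hm
    -- Interpolation does not give the coefficient of `xy`, but `τ_a` sends `q` to `-q`.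
    have e := h0.toIsAxis.tau_mul q m
    have hqm := (h.mul_mem hm).2.2
    rw [tau_perp (h.two_smul_axis_mul_mul g0 h0 hm), tau_perp (h.two_smul_axis_mul_mul g0 h0 hqm),
      (h.tau_frame g0).2.2, ← hK] at e
    simp only [mul_zero, zero_smul, one_smul, zero_sub, add_zero, Kq m hm, mul_sub, neg_mul,
      qK m hm, mul_smul_comm] at e
    refine smul_right_injective A (NeZero.ne (2 : F)) ?_
    simp only
    linear_combination (norm := module) -e
  have bil : ∀ u ∈ M, ∀ v ∈ M, P (K (u * v) - K u * K v - (4 : F) • ((p * u) * (p * v))) = 0 ∧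
      P ((-2 : F) • (p * (u * v) - (p * u) * K v - K u * (p * v))) = 0 ∧
      P ((-2 : F) • (q * (u * v) - (q * u) * K v - K u * (q * v))) = 0 ∧
      P ((-4 : F) • ((q * u) * (q * v) - d • ((p * u) * (p * v)))) = 0 := by
    intro u hu v hv
    have k0 := h.conic_tau_mul g0 h0 hu hv
    have k1 := h.conic_tau_mul g1 h1 hu hv
    have k1' := h.conic_tau_mul g1' h1' hu hv
    have k2 := h.conic_tau_mul g2 h2 hu hv
    have k2' := h.conic_tau_mul g2' h2' hu hv
    simp only [← hP, ← hK] at k0 k1 k1' k2 k2'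
    refine eq_zero_of_conic hx1 hx2 ?_ ?_ ?_ ?_ ?_
      (k₃ := P ((-4 : F) • ((p * u) * (q * v) + (q * u) * (p * v))))
    · linear_combination (norm := module) k0
    · linear_combination (norm := module) k1
    · linear_combination (norm := module) k1'
    · linear_combination (norm := module) k2
    · linear_combination (norm := module) k2'
  have n2 : (-2 : F) ≠ 0 := neg_ne_zero.2 (NeZero.ne _)
  have n4 : (-4 : F) ≠ 0 := by
    have : (-4 : F) = -2 * 2 := by norm_num
    rw [this]; exact mul_ne_zero n2 (NeZero.ne _)
  have Kmul : ∀ u ∈ M, ∀ v ∈ M, P (K (u * v)) = P (K u * K v + (4 : F) • ((p * u) * (p * v))) := by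
    intro u hu v hv
    rw [← sub_eq_zero, ← map_sub, ← sub_sub]
    exact (bil u hu v hv).1
  have pmul : ∀ u ∈ M, ∀ v ∈ M, P (p * (u * v)) = P ((p * u) * K v + K u * (p * v)) := by
    intro u hu v hv
    have := (bil u hu v hv).2.1
    rw [map_smul, smul_eq_zero_iff_right n2] at this
    rw [← sub_eq_zero, ← map_sub, ← sub_sub]
    exact this
  have qmul : ∀ u ∈ M, ∀ v ∈ M, P (q * (u * v)) = P ((q * u) * K v + K u * (q * v)) := by
    intro u hu v hv
    have := (bil u hu v hv).2.2.1
    rw [map_smul, smul_eq_zero_iff_right n2] at this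
    rw [← sub_eq_zero, ← map_sub, ← sub_sub]
    exact this
  have qmulq : ∀ u ∈ M, ∀ v ∈ M, P ((q * u) * (q * v)) = d • P ((p * u) * (p * v)) := by
    intro u hu v hv
    have := (bil u hu v hv).2.2.2
    rw [map_smul, smul_eq_zero_iff_right n4, map_sub, map_smul, sub_eq_zero] at this
    exact this
  refine { h with
    sign_p := Kp, p_sign := pK, sign_q := Kq, q_sign := qK, sign_sign := KK, q_q := qq, q_p := qp
    sign_mul := Kmul, p_mul := pmul, q_mul := qmul, q_mul_q := qmulq, p_mul_q := ?_ }
  intro u hu v hv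
  have hpu := (h.mul_mem hu).2.1
  have hqu := (h.mul_mem hu).2.2
  have hpv := (h.mul_mem hv).2.1
  have hqv := (h.mul_mem hv).2.2
  -- `n`, the coefficient of `xy` up to a factor, is annihilated by `p` and by `K`, whereas
  -- `K² + 4 L_p² = 1` on `M`.
  set n := P ((p * u) * (q * v) + (q * u) * (p * v)) with hn
  have pn : p * n = 0 := by
    rw [hn, (h.mul_perpProj _).2.1, mul_add, map_add, ← hP, pmul _ hpu _ hqv, pmul _ hqu _ hpv,
      Kp u hu, Kp v hv, Kq u hu, Kq v hv]
    simp
  have Kn : K n = 0 := by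
    have e := qmulq _ hpu _ hqv
    rw [qp u hu, qq v hv, neg_mul, mul_smul_comm, map_neg, map_smul, ← smul_neg] at e
    have e' := smul_right_injective A h.d_ne_zero e
    rw [hn, hK, ← h.perpProj_peirceSign, ← hK, ← hP, map_add, map_add, Kmul _ hpu _ hqv,
      Kmul _ hqu _ hpv, Kp u hu, Kp v hv, Kq u hu, Kq v hv]
    simp only [zero_mul, zero_add, map_smul, ← e', smul_neg, neg_add_cancel]
  have := KK n (h.perpProj_mem _)
  rwa [Kn, pn, map_zero, mul_zero, smul_zero, sub_zero, eq_comm] at this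

end IsSpinFrame

/-! ### Idempotents of a solid frame -/

namespace IsSolidFrame

variable {B : LinearMap.BilinForm F A} {i p q : A} {d : F} [NeZero (2 : F)] {x y : F}

theorem two_smul_conicPoint_mul_mul (h : IsSolidFrame B i p q d) (hxy : x ^ 2 + d * y ^ 2 = 1)
    {m : A} (hm : m ∈ framePerp B i p q) :
    (2 : F) • (conicPoint i p q x y * (conicPoint i p q x y * m)) = conicPoint i p q x y * m := by
  have r1 := h.sign_p m hm
  have r2 := h.p_sign m hm
  have r3 := h.sign_q m hm
  have r4 := h.q_sign m hm
  have r5 := h.sign_sign m hm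
  have r6 := h.q_q m hm
  have r7 := h.q_p m hm
  simp only [peirceSign_apply, mul_sub, mul_smul_comm] at r1 r2 r3 r4 r5
  have h2 : (2 : F) ≠ 0 := NeZero.ne _
  have e : (i + x • p + y • q) * ((i + x • p + y • q) * m) = (i + x • p + y • q) * m := by
    refine smul_right_injective A (mul_ne_zero h2 h2) ?_
    simp only [add_mul, mul_add, smul_mul_assoc, mul_smul_comm]
    linear_combination (norm := module) r5 - (2 * x) • (r1 + r2) - (2 * y) • (r3 + r4)
      + (4 * y ^ 2) • r6 + (4 * x * y) • r7 + (4 * hxy) • (p * (p * m))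
  rw [← IsSpinFrame.two_smul_conicPoint] at e
  refine smul_right_injective A h2 ?_
  simp only [smul_mul_assoc, mul_smul_comm] at e ⊢
  exact e

theorem perpProj_tau_mul (h : IsSolidFrame B i p q d) (hxy : x ^ 2 + d * y ^ 2 = 1)
    {u v : A} (hu : u ∈ framePerp B i p q) (hv : v ∈ framePerp B i p q) :
    perpProj B i p q d (tau (F := F) (conicPoint i p q x y) (u * v))
      = perpProj B i p q d (tau (F := F) (conicPoint i p q x y) u
          * tau (F := F) (conicPoint i p q x y) v) := by
  rw [h.perpProj_tau, IsSpinFrame.tau_perp (h.two_smul_conicPoint_mul_mul hxy hu),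
    IsSpinFrame.tau_perp (h.two_smul_conicPoint_mul_mul hxy hv),
    IsSpinFrame.tau_perp (h.two_smul_conicPoint_mul_mul hxy (h.perpProj_mem _)),
    ← h.perpProj_peirceSign, (h.mul_perpProj _).2.1, (h.mul_perpProj _).2.2,
    h.sign_mul u hu v hv, h.p_mul u hu v hv, h.q_mul u hu v hv]
  have r1 := h.q_mul_q u hu v hv
  have r2 := h.p_mul_q u hu v hv
  simp only [sub_mul, mul_sub, add_mul, mul_add, smul_mul_assoc, mul_smul_comm, map_add, map_sub,
    map_smul] at r2 ⊢
  linear_combination (norm := module) (-4 * y ^ 2) • r1 - (4 * x * y) • r2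
    - (4 * hxy) • (perpProj B i p q d ((p * u) * (p * v)))

theorem tau_frame_mul_perp (h : IsSolidFrame B i p q d) (hxy : x ^ 2 + d * y ^ 2 = 1)
    (r s t : F) {m : A} (hm : m ∈ framePerp B i p q) :
    tau (F := F) (conicPoint i p q x y) ((r • i + s • p + t • q) * m)
      = tau (F := F) (conicPoint i p q x y) (r • i + s • p + t • q)
          * tau (F := F) (conicPoint i p q x y) m := by
  obtain ⟨f1, f2, f3⟩ := h.tau_frame hxy
  obtain ⟨m1, m2, m3⟩ := h.mul_mem hm
  have key : ∀ {m : A}, m ∈ framePerp B i p q → tau (F := F) (conicPoint i p q x y) m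
      = peirceSign (F := F) i m - (2 : F) • (x • (p * m) + y • (q * m)) := fun hm =>
    IsSpinFrame.tau_perp (h.two_smul_conicPoint_mul_mul hxy hm)
  have r1 := h.sign_p m hm
  have r2 := h.p_sign m hm
  have r3 := h.sign_q m hm
  have r4 := h.q_sign m hm
  have r6 := h.q_q m hm
  have r7 := h.q_p m hm
  have r8 : p * (i * m) = i * (p * m) := by
    have := r2.trans r1.symm
    simp only [peirceSign_apply, mul_sub, mul_smul_comm] at this
    exact smul_right_injective A (NeZero.ne (2 : F)) (sub_right_injective this)
  have r9 : q * (i * m) = i * (q * m) := by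
    have := r4.trans r3.symm
    simp only [peirceSign_apply, mul_sub, mul_smul_comm] at this
    exact smul_right_injective A (NeZero.ne (2 : F)) (sub_right_injective this)
  have r0 : peirceSign (F := F) i (i * m) = i * peirceSign (F := F) i m := by
    simp only [peirceSign_apply, mul_sub, mul_smul_comm]
  simp only [add_mul, smul_mul_assoc, map_add, map_smul, f1, f2, f3, key hm, key m1, key m2,
    key m3, r1, r3, r0, sub_mul, mul_sub, mul_add, mul_smul_comm, r2, r4, r6, r7, r8, r9]
  linear_combination (norm := module) ((4 * s * x + 4 * t * y * d) * hxy) • (p * (p * m))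

theorem isPrimitiveAxis_conicPoint (h : IsSolidFrame B i p q d) (hxy : x ^ 2 + d * y ^ 2 = 1) :
    IsPrimitiveAxis F (conicPoint i p q x y) := by
  set c := conicPoint i p q x y with hc
  have adj : ∀ u v, B (tau (F := F) c u) v = B u (tau (F := F) c v) := by
    intro u v
    have e : ∀ u v, B (c * u) v = B u (c * v) := fun u v => by rw [mul_comm, h.assoc]
    simp only [tau_apply, map_sub, map_smul, LinearMap.sub_apply, LinearMap.smul_apply, e]
  have hcc : c * c = c := h.conicPoint_mul_self hxy
  have hproj : ∀ u, (2 : F) • (c * (c * u)) - c * u = B c u • c := by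
    intro u
    obtain ⟨r, s, t, m, hm, rfl⟩ := h.exists_decomp u
    have e1 := h.conicPoint_proj_frame hxy r s t
    have e2 := h.two_smul_conicPoint_mul_mul hxy hm
    have e3 := IsSpinFrame.form_conicPoint_perp x y hm
    simp only [← hc] at e1 e2 e3
    generalize r • i + s • p + t • q = j at e1 ⊢
    rw [mul_add, mul_add, map_add, e3]
    linear_combination (norm := module) e1 + e2
  have tt : ∀ u, tau (F := F) c (tau (F := F) c u) = u :=
    tau_tau_of_frobenius_proj h.assoc hcc hproj
  refine isPrimitiveAxis_of_frobenius_proj h.assoc (h.conicPoint_ne_zero x y) hcc hproj ?_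
  have fm : ∀ (r s t : F), ∀ m ∈ framePerp B i p q,
      tau (F := F) c ((r • i + s • p + t • q) * m)
        = tau (F := F) c (r • i + s • p + t • q) * tau (F := F) c m :=
    fun r s t m hm => h.tau_frame_mul_perp hxy r s t hm
  have mm : ∀ u ∈ framePerp B i p q, ∀ v ∈ framePerp B i p q,
      tau (F := F) c (u * v) = tau (F := F) c u * tau (F := F) c v := by
    intro u hu v hv
    have hTu : tau (F := F) c u ∈ framePerp B i p q := by
      rw [tau_apply]
      have := h.conicPoint_mul_mem x y hu
      exact sub_mem hu (Submodule.smul_mem _ _ (sub_mem this (h.conicPoint_mul_mem x y this)))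
    -- With `t` the Miyamoto map, `(j, (uv)ᵗ) = (jᵗu, v) = ((j uᵗ)ᵗ, v) = (j, uᵗvᵗ)`.
    have hB : ∀ r s t : F, B (r • i + s • p + t • q)
        (tau (F := F) c (u * v) - tau (F := F) c u * tau (F := F) c v) = 0 := by
      intro r s t
      rw [map_sub, sub_eq_zero, ← adj, ← h.assoc, ← h.assoc, ← adj, fm r s t _ hTu, tt]
    rw [← sub_eq_zero]
    refine IsSpinFrame.eq_zero_of_perpProj (B := B) (i := i) (p := p) (q := q) (d := d) ?_ ?_
    · rw [map_sub, h.perpProj_tau_mul hxy hu hv, sub_self]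
    · rw [mem_framePerp]
      exact ⟨by simpa using hB 1 0 0, by simpa using hB 0 1 0, by simpa using hB 0 0 1⟩
  intro u v
  obtain ⟨r, s, t, m, hm, rfl⟩ := h.exists_decomp u
  obtain ⟨r', s', t', m', hm', rfl⟩ := h.exists_decomp v
  have e1 := h.tau_mul_frame hxy r s t r' s' t'
  have e2 := fm r s t m' hm'
  have e3 := fm r' s' t' m hm
  have e4 := mm m hm m' hm'
  simp only [← hc] at e1
  generalize r • i + s • p + t • q = j at *
  generalize r' • i + s' • p + t' • q = j' at *
  rw [add_mul, mul_add, mul_add, mul_comm m j', map_add, map_add, map_add, e1, e2, e3, e4,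
    map_add, map_add, add_mul, mul_add, mul_add, mul_comm (tau c m) (tau c j')]

end IsSolidFrame

/-! ### The subalgebra generated by two primitive axes -/

variable [NeZero (2 : F)] {B : LinearMap.BilinForm F A} {a b : A}

/-- The identity element is `2 / (α - 1) • σ`, where `α = (a, b)` and `σ = ab - a/2 - b/2`; then
`p = 2a - i`, and `q` is the component of `2b - i` orthogonal to `p`. -/
theorem exists_spinFrame (hB : ∀ u v w : A, B (u * v) w = B u (v * w))
    (hs : ∀ u v : A, B u v = B v u) (ha : IsPrimitiveAxis F a) (hb : IsPrimitiveAxis F b)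
    (haa : B a a = 1) (hbb : B b b = 1) (h0 : B a b ≠ 0) (h1 : B a b ≠ 1) :
    ∃ i p q : A, IsSpinFrame B i p q (1 - (2 * B a b - 1) ^ 2) ∧
      a = conicPoint i p q (1 : F) 0 ∧ b = conicPoint i p q (2 * B a b - 1) 1 := by
  have h2 : (2 : F) ≠ 0 := NeZero.ne _
  set α := B a b with hα
  have hα1 : α - 1 ≠ 0 := sub_ne_zero.2 h1
  have aab : a * (a * b) = (1 / 2 : F) • (a * b + α • a) := by
    rw [hα, ← ha.frobenius_proj hB haa b]; simp [h2]
  have bab : b * (a * b) = (1 / 2 : F) • (a * b + α • b) := by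
    have := hb.frobenius_proj hB hbb a
    rw [hs b a, mul_comm b a] at this
    rw [hα, ← this]; simp [h2]
  set σ := a * b - (1 / 2 : F) • a - (1 / 2 : F) • b with hσ
  have aσ : a * σ = ((α - 1) / 2) • a := by
    simp only [hσ, mul_sub, mul_smul_comm, ha.idem, aab]
    module
  have bσ : b * σ = ((α - 1) / 2) • b := by
    simp only [hσ, mul_sub, mul_smul_comm, hb.idem, bab, mul_comm b a]
    module
  have hσa : σ ∈ adEigenspace F a 1 ⊔ adEigenspace F a 0 := by
    have e : σ = ((α - 1) / 2) • a + (σ - ((α - 1) / 2) • a) := by abel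
    rw [e]
    refine Submodule.add_mem_sup (Submodule.smul_mem _ _ (self_mem_one ha.toIsAxis)) ?_
    rw [mem_zero, mul_sub, aσ, mul_smul_comm, ha.idem, sub_self]
  have abσ : (a * b) * σ = ((α - 1) / 2) • (a * b) := by
    rw [← IsAxis.seress ha b hσa, bσ, mul_smul_comm]
  have σσ : σ * σ = ((α - 1) / 2) • σ := by
    conv_lhs => rw [hσ]
    rw [sub_mul, sub_mul, smul_mul_assoc, smul_mul_assoc, abσ, aσ, bσ, hσ]
    module
  obtain ⟨i, hi⟩ : ∃ i, i = (2 / (α - 1)) • σ := ⟨_, rfl⟩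
  have hc : 2 / (α - 1) * ((α - 1) / 2) = 1 := by field_simp
  have ia : i * a = a := by rw [hi, smul_mul_assoc, mul_comm, aσ, smul_smul, hc, one_smul]
  have ib : i * b = b := by rw [hi, smul_mul_assoc, mul_comm, bσ, smul_smul, hc, one_smul]
  have ii : i * i = i := by
    rw [hi, smul_mul_smul_comm, σσ, smul_smul, mul_assoc, hc, mul_one]
  have hab : a * b = (1 / 2 : F) • ((α - 1) • i + a + b) := by
    rw [hi, hσ]
    match_scalars <;> field_simp <;> ring
  have Bia : B i a = 1 := by rw [← haa, ← ha.idem, ← hB, ia, ha.idem]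
  have Bib : B i b = 1 := by rw [← hbb, ← hb.idem, ← hB, ib, hb.idem]
  have Bii : B i i = 2 := by
    have e : B i (a * b) = α := by rw [← hB, ia]
    rw [hab] at e
    simp only [map_smul, map_add, Bia, Bib, smul_eq_mul] at e
    field_simp at e
    have : (α - 1) * (B i i - 2) = 0 := by linear_combination e
    rcases mul_eq_zero.1 this with h | h
    · exact absurd h hα1
    · linear_combination h
  have ba : b * a = a * b := mul_comm _ _
  have ai : a * i = a := by rw [mul_comm, ia]
  have bi : b * i = b := by rw [mul_comm, ib]
  refine ⟨i, (2 : F) • a - i, (2 : F) • b - i - (2 * α - 1) • ((2 : F) • a - i), ?_, ?_, ?_⟩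
  · refine { assoc := hB, symm := hs, ii := ii, ip := ?_, iq := ?_, pp := ?_, pq := ?_, qq := ?_,
             form_ii := Bii, form_ip := ?_, form_iq := ?_, d_ne_zero := ?_ }
    · simp only [mul_sub, mul_smul_comm, ia, ii]
    · simp only [mul_sub, mul_smul_comm, ia, ib, ii]
    · simp only [mul_sub, sub_mul, mul_smul_comm, smul_mul_assoc, ia, ai, ii, ha.idem]
      module
    · simp only [mul_sub, sub_mul, mul_smul_comm, smul_mul_assoc, ia, ai, ib, ii, ha.idem, hab]
      match_scalars <;> field_simp <;> ring
    · simp only [mul_sub, sub_mul, mul_smul_comm, smul_mul_assoc, ia, ai, ib, bi, ii, ha.idem,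
        hb.idem, ba, hab]
      match_scalars <;> field_simp <;> ring
    · simp only [map_sub, map_smul, Bia, Bii, smul_eq_mul]; ring
    · simp only [map_sub, map_smul, Bia, Bib, Bii, smul_eq_mul]; ring
    · have : (1 : F) - (2 * α - 1) ^ 2 = -(2 * 2 * α * (α - 1)) := by ring
      rw [this]
      exact neg_ne_zero.2 (mul_ne_zero (mul_ne_zero (mul_ne_zero h2 h2) h0) hα1)
  · rw [conicPoint]
    match_scalars <;> field_simp <;> ring
  · rw [conicPoint]
    match_scalars <;> field_simp <;> ring

theorem IsSpinFrame.exists_coords {i p q : A} {d x y : F} (h : IsSpinFrame B i p q d) {c : A}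
    (hc : c ∈ NonUnitalAlgebra.adjoin F {conicPoint i p q (1 : F) 0, conicPoint i p q x y}) :
    ∃ r s t : F, c = r • i + s • p + t • q := by
  induction hc using NonUnitalAlgebra.adjoin_induction with
  | mem z hz =>
    rcases hz with rfl | hz
    · exact ⟨1 / 2, 1 / 2, 0, by rw [conicPoint]; module⟩
    · rw [Set.mem_singleton_iff.1 hz]
      exact ⟨1 / 2, 1 / 2 * x, 1 / 2 * y, by rw [conicPoint]; module⟩
  | zero => exact ⟨0, 0, 0, by module⟩
  | add u v _ _ hu hv =>
    obtain ⟨r, s, t, rfl⟩ := hu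
    obtain ⟨r', s', t', rfl⟩ := hv
    exact ⟨r + r', s + s', t + t', by module⟩
  | mul u v _ _ hu hv =>
    obtain ⟨r, s, t, rfl⟩ := hu
    obtain ⟨r', s', t', rfl⟩ := hv
    refine ⟨r * r' + s * s' + d * t * t', r * s' + s * r', r * t' + t * r', ?_⟩
    simp only [mul_add, add_mul, mul_smul_comm, smul_mul_assoc, h.ii, h.ip, h.iq,
      h.pi, h.pp, h.pq, h.qi, h.qp, h.qq]
    module
  | smul k u _ hu =>
    obtain ⟨r, s, t, rfl⟩ := hu
    exact ⟨k * r, k * s, k * t, by module⟩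

theorem IsSpinFrame.idempotent_eq {i p q : A} {d r s t : F} (h : IsSpinFrame B i p q d) {c : A}
    (hc : c = r • i + s • p + t • q) (hcc : c * c = c) :
    c = 0 ∨ c = i ∨ ∃ x y : F, x ^ 2 + d * y ^ 2 = 1 ∧ c = conicPoint i p q x y := by
  have h2 : (2 : F) ≠ 0 := NeZero.ne _
  have hd := h.d_ne_zero
  have bi : B i c = 2 * r := by
    simp [hc, h.form_ii, h.form_ip, h.form_iq, mul_comm]
  have bp : B p c = 2 * s := by
    simp [hc, h.form_pi, h.form_pp, h.form_pq, mul_comm]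
  have bq : B q c = 2 * d * t := by
    simp [hc, h.form_qi, h.form_qp, h.form_qq, mul_comm]
  have e : c * c = (r * r + s * s + d * t * t) • i + (2 * r * s) • p + (2 * r * t) • q := by
    simp only [hc, mul_add, add_mul, mul_smul_comm, smul_mul_assoc, h.ii, h.ip, h.iq,
      h.pi, h.pp, h.pq, h.qi, h.qp, h.qq]
    module
  rw [hcc] at e
  have ei : r * r + s * s + d * t * t = r := by
    rw [e] at bi
    simp only [map_add, map_smul, h.form_ii, h.form_ip, h.form_iq, smul_eq_mul] at bi
    exact mul_left_cancel₀ h2 (by linear_combination bi)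
  have ep : (2 * r - 1) * s = 0 := by
    rw [e] at bp
    simp only [map_add, map_smul, h.form_pi, h.form_pp, h.form_pq, smul_eq_mul] at bp
    exact mul_left_cancel₀ h2 (by linear_combination bp)
  have eq : (2 * r - 1) * t = 0 := by
    rw [e] at bq
    simp only [map_add, map_smul, h.form_qi, h.form_qp, h.form_qq, smul_eq_mul] at bq
    exact mul_left_cancel₀ (mul_ne_zero h2 hd) (by linear_combination bq)
  by_cases hr : 2 * r - 1 = 0
  · right; right
    have hr' : r = 1 / 2 := by field_simp; linear_combination hr
    refine ⟨2 * s, 2 * t, ?_, ?_⟩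
    · linear_combination 4 * ei - (2 * r - 1) * hr
    · rw [hc, hr', conicPoint]
      match_scalars <;> field_simp
  · have hs : s = 0 := (mul_eq_zero.1 ep).resolve_left hr
    have ht : t = 0 := (mul_eq_zero.1 eq).resolve_left hr
    subst hs ht
    have : r * (r - 1) = 0 := by linear_combination ei
    rcases mul_eq_zero.1 this with h | h
    · left; simp [hc, h]
    · right; left; simp [hc, sub_eq_zero.1 h]

end SpinFrames

end JordanHalf

theorem theorem1 {F A : Type*} [Field F] [NeZero (2 : F)]
    [NonUnitalNonAssocCommRing A] [Nontrivial A] [Module F A]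
    [IsScalarTower F A A] [SMulCommClass F A A]
    {X : Set A} (hX : JordanHalf.IsJordanTypeHalf F X)
    (a b : A) (ha : JordanHalf.IsPrimitiveAxis F a) (hb : JordanHalf.IsPrimitiveAxis F b)
    (hα : JordanHalf.frobeniusForm hX a b ∉ ({0, 1 / 4, 1} : Set F)) :
    JordanHalf.IsSolid F (NonUnitalAlgebra.adjoin F {a, b}) := by
  obtain ⟨B, hB, hone⟩ := JordanHalf.exists_assoc_form hX
  have hfrob : JordanHalf.frobeniusForm hX = B := by
    refine (JordanHalf.existsUnique_frobeniusForm hX).unique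
      (JordanHalf.frobeniusForm_spec hX) ⟨?_, hB, fun x hx => hone x (hX.axes x hx)⟩
    rintro rfl
    simpa using hone a ha
  rw [hfrob] at hα
  simp only [Set.mem_insert_iff, Set.mem_singleton_iff, not_or] at hα
  obtain ⟨h0, h4, h1⟩ := hα
  have h2 : (2 : F) ≠ 0 := NeZero.ne _
  obtain ⟨i, p, q, hf, hfa, hfb⟩ := JordanHalf.exists_spinFrame hB
    (JordanHalf.symm_of_assoc hX hB) ha hb (hone a ha) (hone b hb) h0 h1
  generalize hx : 2 * B a b - 1 = x at hf hfb
  have hx1 : x ≠ 1 := by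
    rw [← hx]
    intro h
    exact h1 (mul_left_cancel₀ h2 (by linear_combination h))
  have hx2 : 1 + 2 * x ≠ 0 := by
    rw [← hx]
    intro h
    apply h4
    have h4' : (4 : F) ≠ 0 := by
      have : (4 : F) = 2 * 2 := by norm_num
      rw [this]; exact mul_ne_zero h2 h2
    rw [eq_div_iff h4']
    linear_combination h
  have hs := hf.isSolidFrame (by ring) hx1 hx2 (hfa ▸ ha) (hfb ▸ hb)
  intro c hc hcc hc0 hc1
  rw [hfa, hfb] at hc hc1
  obtain ⟨r, s, t, e⟩ := hf.exists_coords hc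
  rcases hf.idempotent_eq e hcc with h | h | ⟨z, w, hzw, h⟩
  · exact absurd h hc0
  · refine absurd (fun u hu => ?_) hc1
    obtain ⟨r, s, t, rfl⟩ := hf.exists_coords hu
    simp only [h, mul_add, mul_smul_comm, hf.ii, hf.ip, hf.iq]
  · rw [h]
    exact hs.isPrimitiveAxis_conicPoint hzw
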